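/- Let $X_0, X_1, X_2, \dots$ be independent real random variables on a common probability space with $\sup_j E|X_j|^3<\infty$, common mean $E(X_j)=m$ and common variance $\mathrm{Var}(X_j)=\sigma^2$, where $\sigma>0$. Number rows and columns of $n\times n$ matrices by $0,1,\dots,n-1$. For $n\ge 1$ let ${\bf A}_n$ be the $n\times n$ random symmetric circulant matrix $[{\bf A}_n]_{i,j}=a^{(n)}_{(i-j)\bmod n}$ whose first row $(a^{(n)}_0,\dots,a^{(n)}_{n-1})$ is given by $a^{(n)}_j=X_j$ for $0\le j\le\lfloor n/2\rfloor$ and $a^{(n)}_j=a^{(n)}_{n-j}$ for $\lfloor n/2\rfloor<j\le n-1$. Let ${\bf T}_n$ be the $n\times n$ random palindromic Toeplitz matrix $[{\bf T}_n]_{i,j}=b^{(n)}_{|i-j|}$, where $b^{(n)}_j=X_j$ for $0\le j\le\lfloor (n-1)/2\rfloor$ and $b^{(n)}_j=b^{(n)}_{n-1-j}$ for $\lfloor (n-1)/2\rfloor<j\le n-1$. The spectral measure of a real symmetric $n\times n$ matrix with eigenvalues $\lambda_1,\dots,\lambda_n$ (counted with multiplicity) is the probability measure $\frac1n\sum_{i=1}^n\delta_{\lambda_i}$.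 Then, with probability $1$, the spectral measure of $\frac{1}{\sigma\sqrt n}{\bf A}_n$ converges weakly to the standard normal law $N(0,1)$ as $n\to\infty$; and, with probability $1$, the spectral measure of $\frac{1}{\sigma\sqrt n}{\bf T}_n$ converges weakly to $N(0,1)$ as $n\to\infty$. -/

import Mathlib

open MeasureTheory ProbabilityTheory Filter Topology

/-- The first row `(x 0, x 1, …, x ⌊n/2⌋, …, x 2, x 1)` of a symmetric circulant matrix of
size `n`: the entry in column `j` (columns are numbered from `0`) is `x j` for `j ≤ n / 2`, and
equals the entry in column `n - j` for the other `j`. -/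
def symCirculantRow (x : ℕ → ℝ) (n : ℕ) (j : Fin n) : ℝ :=
  if (j : ℕ) ≤ n / 2 then x j else x (n - j)

/-- The `n × n` symmetric circulant matrix with first row `symCirculantRow x n`. -/
def symCirculant (x : ℕ → ℝ) (n : ℕ) : Matrix (Fin n) (Fin n) ℝ :=
  Matrix.circulant (symCirculantRow x n)

/-- The first row `(x 0, x 1, …, x 1, x 0)` of a palindromic Toeplitz matrix of size `n`: the
entry in column `j` (columns are numbered from `0`) is `x j` in the first half of the row, and
equals the entry in column `n - 1 - j` in the second half. -/
def palindromicRow (x : ℕ → ℝ) (n : ℕ) (j : ℕ) : ℝ :=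
  if j ≤ (n - 1) / 2 then x j else x (n - 1 - j)

/-- The `n × n` symmetric Toeplitz matrix whose first row is the palindrome
`palindromicRow x n`. -/
def palindromicToeplitz (x : ℕ → ℝ) (n : ℕ) : Matrix (Fin n) (Fin n) ℝ :=
  Matrix.of fun i j => palindromicRow x n (Nat.dist i j)

theorem symCirculant_isHermitian (x : ℕ → ℝ) (n : ℕ) : (symCirculant x n).IsHermitian := by
  ext i j
  simp only [Matrix.conjTranspose_apply, symCirculant, Matrix.circulant_apply, star_trivial,
    symCirculantRow, Fin.val_sub]
  have hi := i.isLt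
  have hj := j.isLt
  rcases lt_trichotomy (i : ℕ) j with h | h | h
  · have e1 : (n - (i : ℕ) + j) % n = j - i := by
      rw [show n - (i : ℕ) + j = (j - i) + n by omega, Nat.add_mod_right]
      exact Nat.mod_eq_of_lt (by omega)
    have e2 : (n - (j : ℕ) + i) % n = n - (j - i) := by
      rw [show n - (j : ℕ) + i = n - (j - i) by omega]
      exact Nat.mod_eq_of_lt (by omega)
    rw [e1, e2]
    split_ifs <;> congr 1 <;> omega
  · rw [h]
  · have e1 : (n - (j : ℕ) + i) % n = i - j := by
      rw [show n - (j : ℕ) + i = (i - j) + n by omega, Nat.add_mod_right]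
      exact Nat.mod_eq_of_lt (by omega)
    have e2 : (n - (i : ℕ) + j) % n = n - (i - j) := by
      rw [show n - (i : ℕ) + j = n - (i - j) by omega]
      exact Nat.mod_eq_of_lt (by omega)
    rw [e1, e2]
    split_ifs <;> congr 1 <;> omega

theorem palindromicToeplitz_isHermitian (x : ℕ → ℝ) (n : ℕ) :
    (palindromicToeplitz x n).IsHermitian := by
  ext i j
  simp [palindromicToeplitz, Nat.dist_comm]

theorem isHermitian_real_smul {ι : Type*} {A : Matrix ι ι ℝ} (hA : A.IsHermitian) (c : ℝ) :
    (c • A).IsHermitian := by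
  ext i j
  simp [← hA.apply i j]

/-- The spectral measure `(1 / N) ∑ᵢ δ_{λᵢ}` of a real symmetric `N × N` matrix, where
`λ₁, …, λ_N` are its eigenvalues counted with multiplicity. -/
noncomputable def spectralMeasure {ι : Type*} [Fintype ι] [DecidableEq ι] [Nonempty ι]
    (A : Matrix ι ι ℝ) (hA : A.IsHermitian) : ProbabilityMeasure ℝ :=
  ⟨(Fintype.card ι : ENNReal)⁻¹ • ∑ i, Measure.dirac (hA.eigenvalues i), ⟨by
    simp [ENNReal.inv_mul_cancel]⟩⟩

/-! A symmetric circulant matrix is diagonalised by the Fourier basis, so its eigenvalues are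
explicit linear forms λ_k = ∑ c_{jk} X_j over j ≤ n/2, with c_{jk} = 2 cos(2πjk/n), the factor 2
becoming 1 at j = 0 and at 2j = n. By Lévy's continuity theorem it suffices that φ_n(t) = n⁻¹ ∑_k
exp(i t λ_k / (σ√n)) tends to exp(-t²/2) almost surely. A common mean only moves λ_0, so the
variables may be taken centred.

Mean: when n does not divide 2k, ∑_j c_{jk}² differs from n by at most 2, so λ_k/√n is a sum of
independent small terms of total variance close to σ², and comparing products of characteristic
functions gives E φ_n(t) → exp(-t²/2) for truncated variables (`norm_integral_circCharFun_sub_le`).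
The at most two other indices have weight 1/n each.

Fluctuations: the variables are truncated at C = n^(1/16). Resampling X_j changes φ_n, to first
order, by a multiple of n^(-3/2) ∑_k w_k c_{jk} with |w_k| ≤ 1, and Bessel's inequality makes the
squares of these changes sum over j to O(C⁴/n). The Efron–Stein inequality, applied to φ_n - E φ_n
and then to its square (real and imaginary parts separately), bounds the fourth central moment by
O(C⁸/n²) = O(n^(-3/2)). This is summable, which the corresponding variance bound is not, so almost
sure convergence follows.

Removing the truncation: by Cauchy–Schwarz and Parseval, φ_n moves by at most a constant times the
root mean square of the change in the variables (`norm_circCharFun_sub_le`). The discarded tails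
vanish in mean square almost surely, by the third moment bound along powers of two.

Toeplitz case: deleting the last row and column of a palindromic Toeplitz matrix of size n + 1
leaves the symmetric circulant of size n. A Hoffman–Wielandt argument shows that the deletion is
invisible in the limit. The normalisation √(n+1) in place of √n is absorbed by proving φ_n(u_n) →
exp(-t²/2) along every u_n → t. -/

/-! ### Fourier analysis of symmetric circulant matrices -/

/-- The multiplicity of the variable `x j` in the first row of a symmetric circulant matrix of
size `n`. -/
def circMult (n j : ℕ) : ℝ := if j = 0 ∨ 2 * j = n then 1 else 2

/-- The coefficient of `x j` in the `k`-th eigenvalue of a symmetric circulant matrix. -/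
noncomputable def circCoeff (n j k : ℕ) : ℝ :=
  circMult n j * Real.cos (2 * Real.pi * j * k / n)

/-- The `k`-th eigenvalue of the symmetric circulant matrix `symCirculant x n`. -/
noncomputable def circEig (x : ℕ → ℝ) (n k : ℕ) : ℝ :=
  ∑ j ∈ Finset.range (n / 2 + 1), circCoeff n j k * x j

lemma circMult_nonneg (n j : ℕ) : 0 ≤ circMult n j := by
  unfold circMult; split_ifs <;> norm_num

lemma circMult_le_two (n j : ℕ) : circMult n j ≤ 2 := by
  unfold circMult; split_ifs <;> norm_num

lemma abs_circCoeff_le (n j k : ℕ) : |circCoeff n j k| ≤ 2 := by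
  rw [circCoeff, abs_mul, abs_of_nonneg (circMult_nonneg n j)]
  have := Real.abs_cos_le_one (2 * Real.pi * j * k / n)
  nlinarith [circMult_nonneg n j, circMult_le_two n j, abs_nonneg (Real.cos (2 * Real.pi * j * k / n))]

/-- Folding a sum over a full symmetric row into a sum over the first half of it. -/
lemma sum_symmetric_row {n : ℕ} (hn : 0 < n) (x G : ℕ → ℝ) (hG : ∀ j, 0 < j → j < n → G (n - j) = G j) :
    ∑ j ∈ Finset.range n, (if j ≤ n / 2 then x j else x (n - j)) * G j =
      ∑ j ∈ Finset.range (n / 2 + 1), circMult n j * (x j * G j) := by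
  have h1 : ∑ j ∈ Finset.range n, (if j ≤ n / 2 then x j else x (n - j)) * G j =
      ∑ j ∈ Finset.range (n / 2 + 1), x j * G j + ∑ j ∈ Finset.Ico (n / 2 + 1) n, x (n - j) * G (n - j) := by
    rw [← Finset.sum_range_add_sum_Ico _ (show n / 2 + 1 ≤ n by omega)]
    congr 1
    · refine Finset.sum_congr rfl fun j hj => ?_
      rw [Finset.mem_range] at hj
      rw [if_pos (by omega)]
    · refine Finset.sum_congr rfl fun j hj => ?_
      rw [Finset.mem_Ico] at hj
      rw [if_neg (by omega), hG j (by omega) (by omega)]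
  have h2 : ∑ j ∈ Finset.Ico (n / 2 + 1) n, x (n - j) * G (n - j) =
      ∑ j ∈ Finset.Ico 1 (n - n / 2), x j * G j := by
    refine Finset.sum_nbij' (fun j => n - j) (fun j => n - j) ?_ ?_ ?_ ?_ ?_ <;>
      intro j hj <;> rw [Finset.mem_Ico] at * <;> omega
  -- The reflected half reaches exactly the indices that occur twice in the row, those of
  -- multiplicity 2, so it carries the weight `circMult n j - 1`.
  have h3 : ∑ j ∈ Finset.Ico 1 (n - n / 2), x j * G j =
      ∑ j ∈ Finset.range (n / 2 + 1), (circMult n j - 1) * (x j * G j) := by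
    have : Finset.Ico 1 (n - n / 2) =
        (Finset.range (n / 2 + 1)).filter (fun j => ¬ (j = 0 ∨ 2 * j = n)) := by
      ext j; simp only [Finset.mem_Ico, Finset.mem_filter, Finset.mem_range]; omega
    rw [this, Finset.sum_filter]
    refine Finset.sum_congr rfl fun j _ => ?_
    unfold circMult
    split_ifs <;> norm_num
  rw [h1, h2, h3, ← Finset.sum_add_distrib]
  exact Finset.sum_congr rfl fun j _ => by ring

lemma cos_symmetric {n : ℕ} (k : ℕ) {j : ℕ} (hj : j < n) :
    Real.cos (2 * Real.pi * (n - j : ℕ) * k / n) = Real.cos (2 * Real.pi * j * k / n) := by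
  have hn : (n : ℝ) ≠ 0 := by
    have : 0 < n := by omega
    positivity
  rw [Nat.cast_sub hj.le, show 2 * Real.pi * ((n : ℝ) - j) * k / n =
    (k : ℕ) * (2 * Real.pi) - 2 * Real.pi * j * k / n by field_simp, Real.cos_nat_mul_two_pi_sub]

lemma circEig_eq_sum_row {n : ℕ} (hn : 0 < n) (x : ℕ → ℝ) (k : ℕ) :
    circEig x n k = ∑ j : Fin n, symCirculantRow x n j * Real.cos (2 * Real.pi * j * k / n) := by
  have := sum_symmetric_row hn x (fun j => Real.cos (2 * Real.pi * j * k / n))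
    (fun j _ hj => cos_symmetric k hj)
  rw [Finset.sum_range] at this
  unfold symCirculantRow
  rw [this, circEig]
  exact Finset.sum_congr rfl fun j _ => by rw [circCoeff]; ring

/-- The sum of the cosines of the multiples of `2 π m / n` over a full period. -/
lemma sum_cos_period {n : ℕ} (hn : 0 < n) (m : ℤ) :
    ∑ j ∈ Finset.range n, Real.cos (2 * Real.pi * j * m / n) = if (n : ℤ) ∣ m then (n : ℝ) else 0 := by
  have hn0 : (n : ℂ) ≠ 0 := by exact_mod_cast hn.ne'
  have hζ := Complex.isPrimitiveRoot_exp n hn.ne'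
  set ζ := Complex.exp (2 * Real.pi * Complex.I / n) with hζd
  have hpow : ∀ j : ℕ, (ζ ^ m) ^ j = Complex.exp ((2 * Real.pi * j * m / n : ℝ) * Complex.I) := by
    intro j
    rw [hζd, ← Complex.exp_int_mul, ← Complex.exp_nat_mul]
    congr 1; push_cast; ring
  have hre : ∑ j ∈ Finset.range n, Real.cos (2 * Real.pi * j * m / n) =
      (∑ j ∈ Finset.range n, (ζ ^ m) ^ j).re := by
    rw [Complex.re_sum]
    refine Finset.sum_congr rfl fun j _ => ?_
    rw [hpow, Complex.exp_ofReal_mul_I_re]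
  rw [hre]
  split_ifs with h
  · rw [(hζ.zpow_eq_one_iff_dvd m).2 h]; simp
  · have h1 : ζ ^ m ≠ 1 := fun h' => h ((hζ.zpow_eq_one_iff_dvd m).1 h')
    rw [geom_sum_eq h1]
    have : (ζ ^ m) ^ n = 1 := by
      rw [← zpow_natCast, ← zpow_mul, mul_comm, zpow_mul, zpow_natCast, hζ.pow_eq_one, one_zpow]
    simp [this]

/-- Bessel's inequality for the cosine transform of length `n`. -/
lemma sum_sq_cos_transform_le {n : ℕ} (hn : 0 < n) (w : ℕ → ℝ) :
    ∑ j ∈ Finset.range n, (∑ k ∈ Finset.range n, w k * Real.cos (2 * Real.pi * j * k / n)) ^ 2 ≤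
      n * ∑ k ∈ Finset.range n, w k ^ 2 := by
  -- Adding the sine transform turns the inequality into Parseval's identity: the products combine
  -- into cosines of differences, and the sum over j kills all terms with k ≠ l.
  have key : ∑ j ∈ Finset.range n, ((∑ k ∈ Finset.range n, w k * Real.cos (2 * Real.pi * j * k / n)) ^ 2
      + (∑ k ∈ Finset.range n, w k * Real.sin (2 * Real.pi * j * k / n)) ^ 2) =
      n * ∑ k ∈ Finset.range n, w k ^ 2 := by
    have h1 : ∀ j : ℕ, (∑ k ∈ Finset.range n, w k * Real.cos (2 * Real.pi * j * k / n)) ^ 2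
      + (∑ k ∈ Finset.range n, w k * Real.sin (2 * Real.pi * j * k / n)) ^ 2 =
      ∑ k ∈ Finset.range n, ∑ l ∈ Finset.range n,
        w k * w l * Real.cos (2 * Real.pi * j * ((k : ℤ) - (l : ℤ) : ℤ) / n) := by
      intro j
      rw [sq, sq, Finset.sum_mul_sum, Finset.sum_mul_sum, ← Finset.sum_add_distrib]
      refine Finset.sum_congr rfl fun k _ => ?_
      rw [← Finset.sum_add_distrib]
      refine Finset.sum_congr rfl fun l _ => ?_
      rw [show 2 * Real.pi * j * (((k : ℤ) - (l : ℤ) : ℤ) : ℝ) / n =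
        2 * Real.pi * j * k / n - 2 * Real.pi * j * l / n by push_cast; ring, Real.cos_sub]
      ring
    simp_rw [h1]
    rw [Finset.sum_comm, Finset.mul_sum]
    refine Finset.sum_congr rfl fun k hk => ?_
    rw [Finset.sum_comm]
    simp_rw [← Finset.mul_sum, sum_cos_period hn]
    rw [Finset.sum_eq_single k]
    · simp; ring
    · intro l hl hlk
      rw [Finset.mem_range] at hk hl
      rw [if_neg, mul_zero]
      intro hd
      have := Int.eq_zero_of_abs_lt_dvd hd (by rw [abs_lt]; omega)
      omega
    · simp_all
  rw [← key]
  exact Finset.sum_le_sum fun j _ => le_add_of_nonneg_right (sq_nonneg _)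

/-- The coefficients satisfy Bessel's inequality in the index of the eigenvalue. -/
lemma sum_sq_sum_circCoeff_le {n : ℕ} (hn : 0 < n) (w : ℕ → ℝ) :
    ∑ j ∈ Finset.range (n / 2 + 1), (∑ k ∈ Finset.range n, w k * circCoeff n j k) ^ 2 ≤
      4 * (n * ∑ k ∈ Finset.range n, w k ^ 2) := by
  refine le_trans ?_ (mul_le_mul_of_nonneg_left (sum_sq_cos_transform_le hn w) (by norm_num))
  rw [Finset.mul_sum]
  refine le_trans (Finset.sum_le_sum fun j _ => ?_) (Finset.sum_le_sum_of_subset_of_nonneg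
    (t := Finset.range n) (Finset.range_mono (show n / 2 + 1 ≤ n by omega)) fun j _ _ => by positivity)
  rw [show ∑ k ∈ Finset.range n, w k * circCoeff n j k = circMult n j *
    ∑ k ∈ Finset.range n, w k * Real.cos (2 * Real.pi * j * k / n) by
      rw [Finset.mul_sum]; exact Finset.sum_congr rfl fun k _ => by rw [circCoeff]; ring, mul_pow]
  refine mul_le_mul_of_nonneg_right ?_ (sq_nonneg _)
  nlinarith [circMult_nonneg n j, circMult_le_two n j]

lemma sum_sq_symCirculantRow_le {n : ℕ} (hn : 0 < n) (x : ℕ → ℝ) :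
    ∑ j ∈ Finset.range n, (if j ≤ n / 2 then x j else x (n - j)) ^ 2 ≤
      2 * ∑ j ∈ Finset.range (n / 2 + 1), x j ^ 2 := by
  have := sum_symmetric_row hn (fun j => x j ^ 2) (fun _ => 1) (fun _ _ _ => rfl)
  have h2 : ∑ j ∈ Finset.range n, (if j ≤ n / 2 then x j else x (n - j)) ^ 2 =
      ∑ j ∈ Finset.range n, (if j ≤ n / 2 then x j ^ 2 else x (n - j) ^ 2) * 1 :=
    Finset.sum_congr rfl fun j _ => by split_ifs <;> ring
  rw [h2, this, Finset.mul_sum]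
  refine Finset.sum_le_sum fun j _ => ?_
  nlinarith [circMult_le_two n j, sq_nonneg (x j)]

/-- The sum of the squares of the eigenvalues. -/
lemma sum_sq_circEig_le {n : ℕ} (hn : 0 < n) (x : ℕ → ℝ) :
    ∑ k ∈ Finset.range n, circEig x n k ^ 2 ≤
      2 * n * ∑ j ∈ Finset.range (n / 2 + 1), x j ^ 2 := by
  have h := sum_sq_cos_transform_le hn (fun j => if j ≤ n / 2 then x j else x (n - j))
  have h2 := sum_sq_symCirculantRow_le hn x
  have h3 : ∑ k ∈ Finset.range n, circEig x n k ^ 2 = ∑ j ∈ Finset.range n, (∑ k ∈ Finset.range n,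
      (if k ≤ n / 2 then x k else x (n - k)) * Real.cos (2 * Real.pi * j * k / n)) ^ 2 := by
    refine Finset.sum_congr rfl fun k _ => ?_
    rw [circEig_eq_sum_row hn, Finset.sum_range]
    unfold symCirculantRow
    congr 1
    refine Finset.sum_congr rfl fun j _ => ?_
    congr 2; ring
  rw [h3]
  calc _ ≤ _ := h
    _ ≤ n * (2 * ∑ j ∈ Finset.range (n / 2 + 1), x j ^ 2) :=
      mul_le_mul_of_nonneg_left h2 (Nat.cast_nonneg n)
    _ = _ := by ring

lemma circEig_sub (x y : ℕ → ℝ) (n k : ℕ) :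
    circEig (fun j => x j - y j) n k = circEig x n k - circEig y n k := by
  simp only [circEig, mul_sub, Finset.sum_sub_distrib]

/-- A constant row contributes to the eigenvalue of index `0` only. -/
lemma circEig_const {n k : ℕ} (hk : 0 < k) (hkn : k < n) (m : ℝ) : circEig (fun _ => m) n k = 0 := by
  rw [circEig_eq_sum_row (by omega)]
  have := sum_cos_period (n := n) (by omega) (k : ℤ)
  rw [if_neg, Finset.sum_range] at this
  · simp only [Int.cast_natCast] at this
    simp [symCirculantRow, ← Finset.mul_sum, this]
  · intro h
    have := Int.le_of_dvd (by exact_mod_cast hk) h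
    omega

/-- The sum of the squared coefficients of an eigenvalue. -/
lemma abs_sum_sq_circCoeff_sub_le {n k : ℕ} (hn : 0 < n) (hk : ¬ n ∣ 2 * k) :
    |∑ j ∈ Finset.range (n / 2 + 1), circCoeff n j k ^ 2 - n| ≤ 2 := by
  have h1 := sum_symmetric_row hn (fun _ => 1) (fun j => Real.cos (2 * Real.pi * j * k / n) ^ 2)
    (fun j _ hj => by simp only [cos_symmetric k hj])
  have h2 : ∑ j ∈ Finset.range n, Real.cos (2 * Real.pi * j * k / n) ^ 2 = n / 2 := by
    have := sum_cos_period hn (2 * k : ℤ)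
    rw [if_neg (by exact_mod_cast hk)] at this
    have h3 : ∑ j ∈ Finset.range n, Real.cos (2 * Real.pi * j * k / n) ^ 2 =
        ∑ j ∈ Finset.range n, (1 / 2 + Real.cos (2 * Real.pi * j * (2 * k : ℤ) / n) / 2) := by
      refine Finset.sum_congr rfl fun j _ => ?_
      rw [Real.cos_sq]; congr 3; push_cast; ring
    rw [h3, Finset.sum_add_distrib, ← Finset.sum_div, ← Finset.sum_div, this]; simp
  simp only [ite_self, one_mul] at h1
  rw [h2] at h1
  -- Since n = 2 ∑ μ cos² while the squared coefficients are μ² cos², the difference has weights μ(2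
  -- - μ), which vanish unless the multiplicity μ is 1.
  have h4 : (n : ℝ) - ∑ j ∈ Finset.range (n / 2 + 1), circCoeff n j k ^ 2 =
      ∑ j ∈ Finset.range (n / 2 + 1),
        (if j = 0 ∨ 2 * j = n then Real.cos (2 * Real.pi * j * k / n) ^ 2 else 0) := by
    have h5 : (n : ℝ) = 2 * ∑ j ∈ Finset.range (n / 2 + 1),
        circMult n j * Real.cos (2 * Real.pi * j * k / n) ^ 2 := by rw [← h1]; ring
    refine (congrArg (· - _) h5).trans ?_
    rw [Finset.mul_sum, ← Finset.sum_sub_distrib]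
    refine Finset.sum_congr rfl fun j _ => ?_
    simp only [circCoeff, circMult]
    split_ifs <;> ring
  rw [abs_sub_comm, h4, ← Finset.sum_filter, abs_of_nonneg (Finset.sum_nonneg fun _ _ => sq_nonneg _)]
  have hcard : ((Finset.range (n / 2 + 1)).filter (fun j => j = 0 ∨ 2 * j = n)).card ≤ 2 := by
    refine le_trans (Finset.card_le_card (t := {0, n / 2}) fun j hj => ?_) Finset.card_le_two
    simp only [Finset.mem_filter, Finset.mem_range, Finset.mem_insert, Finset.mem_singleton] at *
    omega
  refine le_trans (Finset.sum_le_card_nsmul _ _ 1 fun j _ => ?_) ?_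
  · exact Real.cos_sq_le_one _
  · simpa using hcard

/-- The eigenvalues of a symmetric circulant matrix, with multiplicity. -/
lemma symCirculant_eigenvalues {n : ℕ} (hn : 0 < n) (x : ℕ → ℝ)
    (hA : (symCirculant x n).IsHermitian) :
    (Finset.univ.val.map hA.eigenvalues : Multiset ℝ) =
      Finset.univ.val.map (fun k : Fin n => circEig x n k) := by
  have : NeZero n := ⟨hn.ne'⟩
  have hn0 : (n : ℂ) ≠ 0 := by exact_mod_cast hn.ne'
  have hζ := Complex.isPrimitiveRoot_exp n hn.ne'
  set ζ := Complex.exp (2 * Real.pi * Complex.I / n) with hζd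
  have hζ0 : ζ ≠ 0 := Complex.exp_ne_zero _
  -- The columns of V are the characters of ℤ/n. V is an invertible Vandermonde matrix because the
  -- powers of ζ are distinct.
  set V : Matrix (Fin n) (Fin n) ℂ := (Matrix.vandermonde fun k : Fin n => ζ ^ (k : ℕ)).transpose with hV
  have hVdet : IsUnit V := by
    rw [Matrix.isUnit_iff_isUnit_det, isUnit_iff_ne_zero, hV, Matrix.det_transpose,
      Matrix.det_vandermonde_ne_zero_iff]
    intro a b hab
    exact Fin.ext (hζ.pow_inj a.2 b.2 hab)
  have hVapp : ∀ i k : Fin n, V i k = (ζ ^ (k : ℕ)) ^ (i : ℕ) := fun i k => rfl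
  have hpow : ∀ j k : ℕ, (ζ ^ k) ^ j = Complex.exp ((2 * Real.pi * j * k / n : ℝ) * Complex.I) := by
    intro j k
    rw [hζd, ← Complex.exp_nat_mul, ← Complex.exp_nat_mul]
    congr 1; push_cast; ring
  have hmod : ∀ (k a b : ℕ), a % n = b % n → (ζ ^ k) ^ a = (ζ ^ k) ^ b := by
    intro k a b hab
    rw [← pow_mul, ← pow_mul, mul_comm, pow_mul, mul_comm k, pow_mul]
    rw [pow_eq_pow_mod a hζ.pow_eq_one, pow_eq_pow_mod b hζ.pow_eq_one, hab]
  have hVadd : ∀ i j k : Fin n, V (i + j) k = V i k * V j k := by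
    intro i j k
    rw [hVapp, hVapp, hVapp, ← pow_add]
    exact hmod _ _ _ (by rw [Fin.val_add]; simp)
  have hVneg : ∀ m k : Fin n, V m k * V (-m) k = 1 := by
    intro m k
    rw [← hVadd, add_neg_cancel, hVapp]; simp
  have hrow : ∀ m : Fin n, symCirculantRow x n (-m) = symCirculantRow x n m :=
    Matrix.Fin.circulant_isSymm_apply (by
      have := hA
      rwa [Matrix.IsHermitian, Matrix.conjTranspose_eq_transpose_of_trivial] at this)
  have hcos : ∀ m k : Fin n, V m k + V (-m) k =
      2 * ((Real.cos (2 * Real.pi * m * k / n) : ℝ) : ℂ) := by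
    intro m k
    have h1 : V (-m) k = (V m k)⁻¹ := (eq_inv_of_mul_eq_one_right (hVneg m k))
    rw [h1, hVapp, hpow, ← Complex.exp_neg, Complex.ofReal_cos, Complex.cos]
    rw [neg_mul]; ring
  have hsum : ∀ k : Fin n, ∑ m : Fin n, (symCirculantRow x n m : ℂ) * V (-m) k = circEig x n k := by
    intro k
    have h1 : ∑ m : Fin n, (symCirculantRow x n m : ℂ) * V (-m) k =
        ∑ m : Fin n, (symCirculantRow x n m : ℂ) * V m k := by
      rw [← Equiv.sum_comp (Equiv.neg (Fin n))]
      exact Finset.sum_congr rfl fun m _ => by simp [hrow]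
    -- The row is even, so averaging the sum with its reflection replaces each character by its real
    -- part, a cosine.
    have h2 : 2 * ∑ m : Fin n, (symCirculantRow x n m : ℂ) * V (-m) k = 2 * (circEig x n k : ℂ) := by
      rw [two_mul]
      nth_rewrite 1 [h1]
      rw [← Finset.sum_add_distrib, circEig_eq_sum_row hn, Complex.ofReal_sum, Finset.mul_sum]
      refine Finset.sum_congr rfl fun m _ => ?_
      rw [← mul_add, hcos]; push_cast; ring
    exact mul_left_cancel₀ two_ne_zero h2
  have hAV : (symCirculant x n).map (algebraMap ℝ ℂ) * V =
      V * Matrix.diagonal (fun k : Fin n => (circEig x n k : ℂ)) := by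
    ext i k
    rw [Matrix.mul_diagonal, Matrix.mul_apply, ← hsum, Finset.mul_sum,
      ← Equiv.sum_comp (Equiv.subLeft i)]
    refine Finset.sum_congr rfl fun m _ => ?_
    simp only [symCirculant, Matrix.map_apply, Matrix.circulant_apply, Equiv.subLeft_apply,
      sub_sub_cancel, Complex.coe_algebraMap]
    rw [sub_eq_add_neg, hVadd]; ring
  -- Conjugation by V takes place over ℂ; equality of the characteristic polynomials then brings the
  -- real eigenvalues back as a multiset.
  have hchar : ((symCirculant x n).map (algebraMap ℝ ℂ)).charpoly =
      (Matrix.diagonal (fun k : Fin n => (circEig x n k : ℂ))).charpoly := by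
    obtain ⟨U, hU⟩ := hVdet
    rw [← Matrix.charpoly_units_conj U (Matrix.diagonal _), hU, ← hAV, Matrix.mul_assoc, ← hU,
      ← Matrix.coe_units_inv, Units.mul_inv, Matrix.mul_one]
  rw [Matrix.charpoly_map, hA.charpoly_eq, Matrix.charpoly_diagonal, Polynomial.map_prod] at hchar
  have hroots := congrArg Polynomial.roots hchar
  simp only [Polynomial.map_sub, Polynomial.map_X, Polynomial.map_C] at hroots
  rw [Polynomial.roots_prod _ _ (Finset.prod_ne_zero_iff.2 fun _ _ => Polynomial.X_sub_C_ne_zero _),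
    Polynomial.roots_prod _ _ (Finset.prod_ne_zero_iff.2 fun _ _ => Polynomial.X_sub_C_ne_zero _)] at hroots
  simp only [Polynomial.roots_X_sub_C, Multiset.bind_singleton] at hroots
  refine Multiset.map_injective Complex.ofReal_injective ?_
  simpa [Multiset.map_map, Function.comp_def] using hroots

/-! ### Efron–Stein inequality and its fourth moment form -/

section EfronStein

lemma integrable_of_measurable_of_abs_le {α : Type*} [MeasurableSpace α] {μ : Measure α}
    [IsFiniteMeasure μ] {f : α → ℝ} (hf : Measurable f) {K : ℝ} (hK : ∀ x, |f x| ≤ K) :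
    Integrable f μ :=
  Integrable.of_bound hf.aestronglyMeasurable K (ae_of_all _ hK)

lemma sq_integral_le_integral_sq {α : Type*} [MeasurableSpace α] {μ : Measure α}
    [IsProbabilityMeasure μ] {f : α → ℝ} (hf : Measurable f) {K : ℝ} (hK : ∀ x, |f x| ≤ K) :
    (∫ x, f x ∂μ) ^ 2 ≤ ∫ x, f x ^ 2 ∂μ := by
  have h := variance_nonneg f μ
  rw [variance_eq_sub (MemLp.of_bound hf.aestronglyMeasurable K (ae_of_all _ hK))] at h
  simpa using h

lemma abs_integral_le_of_abs_le {α : Type*} [MeasurableSpace α] {μ : Measure α}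
    [IsProbabilityMeasure μ] {f : α → ℝ} {K : ℝ} (hK : ∀ x, |f x| ≤ K) :
    |∫ x, f x ∂μ| ≤ K := by
  simpa using norm_integral_le_of_norm_le_const (μ := μ) (f := f) (C := K) (ae_of_all _ hK)

/-- Twice the variance as the mean square difference of two independent copies. -/
lemma variance_eq_half_integral_sq_sub {μ : Measure ℝ} [IsProbabilityMeasure μ] {u : ℝ → ℝ}
    (hu : Measurable u) {K : ℝ} (hK : ∀ x, |u x| ≤ K) :
    ∫ a, u a ^ 2 ∂μ - (∫ a, u a ∂μ) ^ 2 = 1 / 2 * ∫ a, ∫ b, (u a - u b) ^ 2 ∂μ ∂μ := by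
  have hi : Integrable u μ := integrable_of_measurable_of_abs_le hu hK
  have hi2 : Integrable (fun a => u a ^ 2) μ :=
    integrable_of_measurable_of_abs_le (K := K ^ 2) (hu.pow_const 2) fun x => by
      rw [abs_pow]; exact pow_le_pow_left₀ (abs_nonneg _) (hK x) 2
  have h1 : ∀ a, ∫ b, (u a - u b) ^ 2 ∂μ =
      u a ^ 2 - 2 * u a * ∫ b, u b ∂μ + ∫ b, u b ^ 2 ∂μ := by
    intro a
    have : ∀ b, (u a - u b) ^ 2 = u a ^ 2 - 2 * u a * u b + u b ^ 2 := fun b => by ring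
    simp_rw [this]
    have e1 : Integrable (fun b => 2 * u a * u b) μ := hi.const_mul _
    have e2 : Integrable (fun b => u a ^ 2 - 2 * u a * u b) μ := (integrable_const _).sub e1
    rw [integral_add e2 hi2, integral_sub (integrable_const _) e1, integral_const_mul]
    simp
  simp_rw [h1]
  have e1 : Integrable (fun a => 2 * u a * ∫ b, u b ∂μ) μ := (hi.const_mul 2).mul_const _
  have e2 : Integrable (fun a => u a ^ 2 - 2 * u a * ∫ b, u b ∂μ) μ := hi2.sub e1
  rw [integral_add e2 (integrable_const _), integral_sub hi2 e1, integral_mul_const,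
    integral_const_mul]
  simp only [integral_const, probReal_univ, smul_eq_mul, one_mul]
  ring

/-- Fubini with coordinate 0 innermost, the form in which Efron–Stein is proved by induction on the
number of coordinates. -/
lemma integral_pi_fin_succ {N : ℕ} (ν : Fin (N + 1) → Measure ℝ) [∀ i, IsProbabilityMeasure (ν i)]
    {F : (Fin (N + 1) → ℝ) → ℝ} (hF : Measurable F) {K : ℝ} (hK : ∀ x, |F x| ≤ K) :
    ∫ x, F x ∂Measure.pi ν =
      ∫ x, ∫ a, F (Fin.cons a x) ∂ν 0 ∂Measure.pi (fun j : Fin N => ν j.succ) := by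
  have h := (measurePreserving_piFinSuccAbove ν 0).symm
  simp only [Fin.zero_succAbove] at h
  rw [← h.integral_comp', integral_prod_symm]
  · simp [MeasurableEquiv.piFinSuccAbove, Fin.insertNthEquiv]
  · exact integrable_of_measurable_of_abs_le (hF.comp (MeasurableEquiv.measurable _)) fun x => hK _

lemma measurable_fin_cons {N : ℕ} :
    Measurable fun p : ℝ × (Fin N → ℝ) => (Fin.cons p.1 p.2 : Fin (N + 1) → ℝ) := by
  rw [measurable_pi_iff]
  intro i
  refine Fin.cases ?_ (fun j => ?_) i
  · simpa using measurable_fst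
  · simpa [Function.comp_def] using (measurable_pi_apply j).comp measurable_snd

/-- The **Efron–Stein inequality** for a bounded function of independent real variables. -/
theorem efron_stein {N : ℕ} (ν : Fin N → Measure ℝ) [∀ i, IsProbabilityMeasure (ν i)]
    {f : (Fin N → ℝ) → ℝ} (hf : Measurable f) {K : ℝ} (hK : ∀ x, |f x| ≤ K) :
    ∫ x, f x ^ 2 ∂Measure.pi ν - (∫ x, f x ∂Measure.pi ν) ^ 2 ≤
      1 / 2 * ∑ j, ∫ x, ∫ y, (f x - f (Function.update x j y)) ^ 2 ∂ν j ∂Measure.pi ν := by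
  induction N with
  | zero =>
    have : f = fun _ => f default := funext fun x => congrArg f (Subsingleton.elim _ _)
    rw [this]; simp
  | succ N ih =>
    set μ := Measure.pi fun j : Fin N => ν j.succ with hμ
    have hK0 : 0 ≤ K := (abs_nonneg _).trans (hK default)
    have hsq : ∀ {t : ℝ}, |t| ≤ K → |t ^ 2| ≤ K ^ 2 := fun h => by
      rw [abs_pow]; exact pow_le_pow_left₀ (abs_nonneg _) h 2
    have hdiff : ∀ {s t : ℝ}, |s| ≤ K → |t| ≤ K → |(s - t) ^ 2| ≤ (2 * K) ^ 2 := fun hs ht => by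
      rw [abs_pow]
      refine pow_le_pow_left₀ (abs_nonneg _) ((abs_sub _ _).trans (by linarith)) 2
    have hfc : Measurable fun p : ℝ × (Fin N → ℝ) => f (Fin.cons p.1 p.2) :=
      hf.comp measurable_fin_cons
    -- h is f with its first coordinate averaged out. The variance splits as Var f = (E f² - E h²) +
    -- Var h, and the induction hypothesis handles Var h.
    set h : (Fin N → ℝ) → ℝ := fun x => ∫ a, f (Fin.cons a x) ∂ν 0 with hh
    have hhm : Measurable h := (hfc.stronglyMeasurable.integral_prod_left' (μ := ν 0)).measurable
    have hhK : ∀ x, |h x| ≤ K := fun x => abs_integral_le_of_abs_le fun a => hK _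
    have hcol : ∀ x, Measurable fun a => f (Fin.cons a x) := fun x => hfc.comp measurable_prodMk_right
    -- the contribution of the first coordinate
    have h0 : ∫ x, ∫ y, (f x - f (Function.update x 0 y)) ^ 2 ∂ν 0 ∂Measure.pi ν =
        2 * (∫ x, f x ^ 2 ∂Measure.pi ν - ∫ x, h x ^ 2 ∂μ) := by
      have hm : Measurable fun x : Fin (N + 1) → ℝ =>
          ∫ y, (f x - f (Function.update x 0 y)) ^ 2 ∂ν 0 :=
        (((hf.comp measurable_fst).sub (hf.comp measurable_update')).pow_const
          2).stronglyMeasurable.integral_prod_right'.measurable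
      rw [integral_pi_fin_succ ν hm (K := (2 * K) ^ 2)
        (fun x => abs_integral_le_of_abs_le fun y => hdiff (hK _) (hK _)),
        integral_pi_fin_succ ν (hf.pow_const 2) (fun x => hsq (hK x)), ← integral_sub, ← integral_const_mul]
      · refine integral_congr_ae (ae_of_all _ fun x => ?_)
        simp only [Fin.update_cons_zero]
        have := variance_eq_half_integral_sq_sub (μ := ν 0) (hcol x) (fun a => hK _)
        simp only [hh]
        linarith
      · exact integrable_of_measurable_of_abs_le (K := K ^ 2)
          (hfc.pow_const 2).stronglyMeasurable.integral_prod_left'.measurable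
          (fun x => abs_integral_le_of_abs_le fun y => hsq (hK _))
      · exact integrable_of_measurable_of_abs_le (hhm.pow_const 2) fun x => hsq (hhK x)
    -- Averaging over the first coordinate can only reduce the sensitivity to the others, by
    -- Jensen's inequality.
    have h1 : ∀ j : Fin N, ∫ x, ∫ y, (h x - h (Function.update x j y)) ^ 2 ∂ν j.succ ∂μ ≤
        ∫ x, ∫ y, (f x - f (Function.update x j.succ y)) ^ 2 ∂ν j.succ ∂Measure.pi ν := by
      intro j
      have hm : Measurable fun x : Fin (N + 1) → ℝ =>
          ∫ y, (f x - f (Function.update x j.succ y)) ^ 2 ∂ν j.succ :=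
        (((hf.comp measurable_fst).sub (hf.comp measurable_update')).pow_const
          2).stronglyMeasurable.integral_prod_right'.measurable
      rw [integral_pi_fin_succ ν hm (K := (2 * K) ^ 2)
        (fun x => abs_integral_le_of_abs_le fun y => hdiff (hK _) (hK _))]
      simp only [← Fin.cons_update]
      have hm3 : Measurable fun p : (Fin N → ℝ) × (ℝ × ℝ) =>
          (f (Fin.cons p.2.1 p.1) - f (Fin.cons p.2.1 (Function.update p.1 j p.2.2))) ^ 2 := by
        refine Measurable.pow_const (Measurable.sub ?_ ?_) 2
        · exact hfc.comp ((measurable_fst.comp measurable_snd).prodMk measurable_fst)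
        · exact hfc.comp ((measurable_fst.comp measurable_snd).prodMk
            (measurable_update'.comp (measurable_fst.prodMk (measurable_snd.comp measurable_snd))))
      have hm2 : ∀ x, Measurable fun p : ℝ × ℝ =>
          (f (Fin.cons p.1 x) - f (Fin.cons p.1 (Function.update x j p.2))) ^ 2 :=
        fun x => hm3.comp measurable_prodMk_left
      have hswap : ∀ x, ∫ a, ∫ y, (f (Fin.cons a x) - f (Fin.cons a (Function.update x j y))) ^ 2
            ∂ν j.succ ∂ν 0 =
          ∫ y, ∫ a, (f (Fin.cons a x) - f (Fin.cons a (Function.update x j y))) ^ 2 ∂ν 0 ∂ν j.succ :=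
        fun x => integral_integral_swap (integrable_of_measurable_of_abs_le (hm2 x)
          fun p => hdiff (hK _) (hK _))
      have hjen : ∀ x y, (h x - h (Function.update x j y)) ^ 2 ≤
          ∫ a, (f (Fin.cons a x) - f (Fin.cons a (Function.update x j y))) ^ 2 ∂ν 0 := by
        intro x y
        simp only [hh]
        rw [← integral_sub (integrable_of_measurable_of_abs_le (hcol _) fun _ => hK _)
          (integrable_of_measurable_of_abs_le (hcol _) fun _ => hK _)]
        exact sq_integral_le_integral_sq ((hcol x).sub (hcol _)) (K := 2 * K)
          fun a => (abs_sub _ _).trans ((add_le_add (hK _) (hK _)).trans_eq (two_mul K).symm)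
      refine integral_mono ?_ ?_ fun x => ?_
      · refine integrable_of_measurable_of_abs_le (K := (2 * K) ^ 2) ?_
          (fun x => abs_integral_le_of_abs_le fun y => hdiff (hhK _) (hhK _))
        exact (((hhm.comp measurable_fst).sub (hhm.comp measurable_update')).pow_const
          2).stronglyMeasurable.integral_prod_right'.measurable
      · refine integrable_of_measurable_of_abs_le (K := (2 * K) ^ 2) ?_
          (fun x => abs_integral_le_of_abs_le fun a => abs_integral_le_of_abs_le fun y =>
            hdiff (hK _) (hK _))
        have := hm.comp (measurable_fin_cons (N := N))
        have := (this.stronglyMeasurable.integral_prod_left' (μ := ν 0)).measurable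
        simpa only [Function.comp_def, ← Fin.cons_update] using this
      · simp only
        rw [hswap]
        refine integral_mono ?_ ?_ fun y => hjen x y
        · refine integrable_of_measurable_of_abs_le (K := (2 * K) ^ 2) ?_
            (fun y => hdiff (hhK _) (hhK _))
          exact ((measurable_const.sub (hhm.comp (measurable_update x))).pow_const 2)
        · refine integrable_of_measurable_of_abs_le (K := (2 * K) ^ 2) ?_
            (fun y => abs_integral_le_of_abs_le fun a => hdiff (hK _) (hK _))
          exact (hm2 x).stronglyMeasurable.integral_prod_left'.measurable
    have hint : ∫ x, f x ∂Measure.pi ν = ∫ x, h x ∂μ := integral_pi_fin_succ ν hf hK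
    have hih := ih (fun j => ν j.succ) hhm hhK
    rw [Fin.sum_univ_succ, h0, hint]
    have := Finset.sum_le_sum fun j (_ : j ∈ Finset.univ) => h1 j
    linarith

/-- A fourth moment version of the Efron–Stein inequality: `d x j` bounds the squared change of
`f` when the coordinate `j` of `x` is changed. -/
theorem integral_pow_four_sub_le {N : ℕ} (ν : Fin N → Measure ℝ) [∀ i, IsProbabilityMeasure (ν i)]
    {f : (Fin N → ℝ) → ℝ} (hf : Measurable f) {K : ℝ} (hK : ∀ x, |f x| ≤ K)
    (d : (Fin N → ℝ) → Fin N → ℝ) {v : ℝ}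
    (hd : ∀ x j y, (f x - f (Function.update x j y)) ^ 2 ≤ d x j) (hv : ∀ x, ∑ j, d x j ≤ v) :
    ∫ x, (f x - ∫ z, f z ∂Measure.pi ν) ^ 4 ∂Measure.pi ν ≤ 4 * v ^ 2 := by
  set μ := Measure.pi ν with hμ
  set e := ∫ z, f z ∂μ with he
  set g : (Fin N → ℝ) → ℝ := fun x => f x - e with hg
  have hgm : Measurable g := hf.sub_const e
  have hgK : ∀ x, |g x| ≤ 2 * K := fun x => (abs_sub _ _).trans (by
    have : |e| ≤ K := abs_integral_le_of_abs_le hK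
    linarith [hK x])
  have hgd : ∀ x j y, (g x - g (Function.update x j y)) ^ 2 ≤ d x j := fun x j y => by
    simpa [hg] using hd x j y
  have hd0 : ∀ x j, 0 ≤ d x j := fun x j => (sq_nonneg _).trans (hd x j 0)
  have hv0 : 0 ≤ v := (Finset.sum_nonneg fun j _ => hd0 0 j).trans (hv 0)
  have hdv : ∀ x j, d x j ≤ v := fun x j =>
    (Finset.single_le_sum (fun i _ => hd0 x i) (Finset.mem_univ j)).trans (hv x)
  have hpow : ∀ k : ℕ, Integrable (fun x => g x ^ k) μ := fun k =>
    integrable_of_measurable_of_abs_le (K := (2 * K) ^ k) (hgm.pow_const k) fun x => by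
      rw [abs_pow]; exact pow_le_pow_left₀ (abs_nonneg _) (hgK x) k
  have hmean : ∫ x, g x ∂μ = 0 := by
    simp only [hg]
    rw [integral_sub (integrable_of_measurable_of_abs_le hf hK) (integrable_const _)]
    simp [he]
  -- This is used twice: for u = g with w = 1, and for u = g² with w = 6g² + 4v.
  have gen : ∀ (u w : (Fin N → ℝ) → ℝ) (B : ℝ), Measurable u → (∀ x, |u x| ≤ B) → Integrable w μ →
      (∀ x j y, (u x - u (Function.update x j y)) ^ 2 ≤ d x j * w x) → (∀ x, 0 ≤ w x) →
      ∑ j, ∫ x, ∫ y, (u x - u (Function.update x j y)) ^ 2 ∂ν j ∂μ ≤ v * ∫ x, w x ∂μ := by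
    intro u w B hu hB hw hdw hw0
    have hb : ∀ x j y, |(u x - u (Function.update x j y)) ^ 2| ≤ (2 * B) ^ 2 := fun x j y => by
      rw [abs_pow]
      exact pow_le_pow_left₀ (abs_nonneg _) ((abs_sub _ _).trans
        (by linarith [hB x, hB (Function.update x j y)])) 2
    have hi : ∀ j, Integrable (fun x => ∫ y, (u x - u (Function.update x j y)) ^ 2 ∂ν j) μ := by
      intro j
      refine integrable_of_measurable_of_abs_le (K := (2 * B) ^ 2) ?_
        fun x => abs_integral_le_of_abs_le fun y => hb x j y
      exact (((hu.comp measurable_fst).sub (hu.comp measurable_update')).pow_const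
          2).stronglyMeasurable.integral_prod_right'.measurable
    rw [← integral_finsetSum _ fun j _ => hi j, ← integral_const_mul]
    refine integral_mono (integrable_finsetSum _ fun j _ => hi j) (hw.const_mul v) fun x => ?_
    calc ∑ j, ∫ y, (u x - u (Function.update x j y)) ^ 2 ∂ν j ≤ ∑ j, d x j * w x := by
          refine Finset.sum_le_sum fun j _ => ?_
          calc _ ≤ ∫ _, d x j * w x ∂ν j := by
                refine integral_mono ?_ (integrable_const _) fun y => hdw x j y
                exact integrable_of_measurable_of_abs_le
                  ((measurable_const.sub (hu.comp (measurable_update x))).pow_const 2) fun y => hb x j y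
            _ = _ := by simp
      _ = (∑ j, d x j) * w x := by rw [Finset.sum_mul]
      _ ≤ v * w x := mul_le_mul_of_nonneg_right (hv x) (hw0 x)
  have hE2 : ∫ x, g x ^ 2 ∂μ ≤ v / 2 := by
    have h1 := efron_stein ν hgm hgK
    have h2 := gen g (fun _ => 1) _ hgm hgK (integrable_const _) (fun x j y => by simpa using hgd x j y)
      (fun _ => zero_le_one)
    rw [← hμ, hmean] at h1
    simp only [integral_const, probReal_univ, smul_eq_mul, mul_one] at h2
    linarith
  have hE2' : 0 ≤ ∫ x, g x ^ 2 ∂μ := integral_nonneg fun x => sq_nonneg _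
  have hE4 : ∫ x, g x ^ 4 ∂μ - (∫ x, g x ^ 2 ∂μ) ^ 2 ≤
      1 / 2 * (v * ∫ x, (6 * g x ^ 2 + 4 * v) ∂μ) := by
    have hB : ∀ x, |g x ^ 2| ≤ (2 * K) ^ 2 := fun x => by
      rw [abs_pow]; exact pow_le_pow_left₀ (abs_nonneg _) (hgK x) 2
    have h1 := efron_stein ν (hgm.pow_const 2) hB
    have h2 := gen (fun x => g x ^ 2) (fun x => 6 * g x ^ 2 + 4 * v) _ (hgm.pow_const 2) hB
      (((hpow 2).const_mul 6).add (integrable_const _)) (fun x j y => ?_) (fun x => by positivity)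
    · simp only [← pow_mul] at h1 h2 ⊢
      norm_num at h1 h2 ⊢
      linarith
    -- Here (a² - b²)² = (a - b)²(a + b)². With δ = a - b and δ² ≤ v, (a + b)² = (2a - δ)² ≤ 6a² +
    -- 3δ² ≤ 6a² + 4v.
    · have e := hgd x j y
      set a := g x
      set b := g (Function.update x j y)
      have : (a ^ 2 - b ^ 2) ^ 2 = (a - b) ^ 2 * (a + b) ^ 2 := by ring
      rw [this]
      refine mul_le_mul e ?_ (sq_nonneg _) (hd0 x j)
      nlinarith [hdv x j, sq_nonneg (3 * a - b), sq_nonneg (a + (a - b)), sq_nonneg (a - b)]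
  -- With E g² ≤ v/2 this gives E g⁴ ≤ v²/4 + (v/2)(3v + 4v) = 15v²/4.
  rw [integral_add ((hpow 2).const_mul 6) (integrable_const _), integral_const_mul] at hE4
  simp only [integral_const, probReal_univ, smul_eq_mul, one_mul] at hE4
  nlinarith

end EfronStein

/-! ### Characteristic functions of spectral measures and their stability -/

section Spectral

lemma norm_exp_mul_I_sub_exp_mul_I_le (a b : ℝ) :
    ‖Complex.exp (a * Complex.I) - Complex.exp (b * Complex.I)‖ ≤ |a - b| := by
  have h := Real.norm_exp_I_mul_ofReal_sub_one_le (x := a - b)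
  have e : Complex.exp (a * Complex.I) - Complex.exp (b * Complex.I) =
      Complex.exp (b * Complex.I) * (Complex.exp (Complex.I * (a - b : ℝ)) - 1) := by
    rw [mul_sub, ← Complex.exp_add, mul_one]
    congr 2; push_cast; ring
  rw [e, norm_mul, Complex.norm_exp_ofReal_mul_I, one_mul]
  exact h

/-- The characteristic function of a spectral measure. -/
lemma charFun_spectralMeasure {ι : Type*} [Fintype ι] [DecidableEq ι] [Nonempty ι]
    (A : Matrix ι ι ℝ) (hA : A.IsHermitian) (t : ℝ) :
    charFun (spectralMeasure A hA : Measure ℝ) t =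
      (Fintype.card ι : ℂ)⁻¹ * ∑ i, Complex.exp ((t * hA.eigenvalues i : ℝ) * Complex.I) := by
  have : (spectralMeasure A hA : Measure ℝ) =
      (Fintype.card ι : ENNReal)⁻¹ • ∑ i, Measure.dirac (hA.eigenvalues i) := rfl
  rw [charFun_apply_real, this, integral_smul_measure, integral_finsetSum_measure]
  · simp only [integral_dirac, ENNReal.toReal_inv, ENNReal.toReal_natCast, Complex.real_smul]
    push_cast
    rfl
  · intro i _
    refine Integrable.of_bound (by fun_prop) 1 (ae_of_all _ fun x => ?_)
    rw [← Complex.ofReal_mul, Complex.norm_exp_ofReal_mul_I]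

/-- The exponential sum is symmetric in the eigenvalues, so an enumeration of the spectrum as a
multiset suffices and no ordering has to be matched. -/
lemma charFun_spectralMeasure_eq_sum {ι κ : Type*} [Fintype ι] [DecidableEq ι] [Nonempty ι]
    [Fintype κ] {A : Matrix ι ι ℝ} (hA : A.IsHermitian) {l : κ → ℝ}
    (hl : (Finset.univ.val.map hA.eigenvalues : Multiset ℝ) = Finset.univ.val.map l) (t : ℝ) :
    charFun (spectralMeasure A hA : Measure ℝ) t =
      (Fintype.card ι : ℂ)⁻¹ * ∑ k, Complex.exp ((t * l k : ℝ) * Complex.I) := by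
  rw [charFun_spectralMeasure]
  congr 1
  have := congrArg (fun s : Multiset ℝ => (s.map fun x => Complex.exp ((t * x : ℝ) * Complex.I)).sum) hl
  simpa [Multiset.map_map, Function.comp_def] using this

lemma isHermitian_diagonalization {ι : Type*} [Fintype ι] [DecidableEq ι] {A : Matrix ι ι ℝ}
    (hA : A.IsHermitian) : ∃ U : Matrix ι ι ℝ, U.transpose * U = 1 ∧ U * U.transpose = 1 ∧
      A * U = U * Matrix.diagonal hA.eigenvalues := by
  have h1 : star (hA.eigenvectorUnitary : Matrix ι ι ℝ) * hA.eigenvectorUnitary = 1 :=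
    Unitary.coe_star_mul_self _
  have h2 : (hA.eigenvectorUnitary : Matrix ι ι ℝ) * star (hA.eigenvectorUnitary : Matrix ι ι ℝ) = 1 :=
    Unitary.coe_mul_star_self _
  refine ⟨hA.eigenvectorUnitary, ?_, ?_, ?_⟩
  · rwa [Matrix.star_eq_conjTranspose, Matrix.conjTranspose_eq_transpose_of_trivial] at h1
  · rwa [Matrix.star_eq_conjTranspose, Matrix.conjTranspose_eq_transpose_of_trivial] at h2
  · have h3 := hA.spectral_theorem
    rw [Unitary.conjStarAlgAut_apply] at h3
    refine (congrArg (fun M => M * (hA.eigenvectorUnitary : Matrix ι ι ℝ)) h3).trans ?_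
    rw [Matrix.mul_assoc, h1, Matrix.mul_one]
    rfl

lemma sum_sq_entries_eq_trace {ι : Type*} [Fintype ι] (M : Matrix ι ι ℝ) :
    ∑ i, ∑ j, M i j ^ 2 = (M.transpose * M).trace := by
  simp only [Matrix.trace, Matrix.diag_apply, Matrix.mul_apply, Matrix.transpose_apply]
  rw [Finset.sum_comm]
  simp only [sq]

/-- A Hoffman–Wielandt type bound: the exponential sums over the spectra of two real symmetric
matrices are close when the matrices are close in Frobenius norm. -/
lemma norm_sum_exp_eigenvalues_sub_le {ι : Type*} [Fintype ι] [DecidableEq ι]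
    {A B : Matrix ι ι ℝ} (hA : A.IsHermitian) (hB : B.IsHermitian) (t : ℝ) :
    ‖∑ i, Complex.exp ((t * hA.eigenvalues i : ℝ) * Complex.I) -
      ∑ i, Complex.exp ((t * hB.eigenvalues i : ℝ) * Complex.I)‖ ≤
    |t| * √(Fintype.card ι * ∑ i, ∑ j, (A i j - B i j) ^ 2) := by
  obtain ⟨U, hU1, hU2, hUA⟩ := isHermitian_diagonalization hA
  obtain ⟨V, hV1, hV2, hVB⟩ := isHermitian_diagonalization hB
  -- W is orthogonal, so the squares of its entries form a doubly stochastic matrix. It serves as a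
  -- coupling of the two spectra, which makes pairing sorted eigenvalues unnecessary.
  set W : Matrix ι ι ℝ := U.transpose * V with hW
  have hW1 : W.transpose * W = 1 := by
    rw [hW, Matrix.transpose_mul, Matrix.transpose_transpose, Matrix.mul_assoc,
      ← Matrix.mul_assoc U, hU2, Matrix.one_mul, hV1]
  have hW2 : W * W.transpose = 1 := by
    rw [hW, Matrix.transpose_mul, Matrix.transpose_transpose, Matrix.mul_assoc,
      ← Matrix.mul_assoc V, hV2, Matrix.one_mul, hU1]
  have hrow : ∀ i, ∑ j, W i j ^ 2 = 1 := fun i => by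
    have := congrFun (congrFun hW2 i) i
    simpa [Matrix.mul_apply, sq] using this
  have hcol : ∀ j, ∑ i, W i j ^ 2 = 1 := fun j => by
    have := congrFun (congrFun hW1 j) j
    simpa [Matrix.mul_apply, sq] using this
  have hAt : A.transpose = A := by
    have := hA
    rwa [Matrix.IsHermitian, Matrix.conjTranspose_eq_transpose_of_trivial] at this
  have hUA' : U.transpose * A = Matrix.diagonal hA.eigenvalues * U.transpose := by
    have := congrArg Matrix.transpose hUA
    rwa [Matrix.transpose_mul, Matrix.transpose_mul, Matrix.diagonal_transpose, hAt] at this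
  -- M has the Frobenius norm of A - B, and its entries are (λ_i - μ_j) W_ij. The coupled cost ∑
  -- W_ij² |λ_i - μ_j| is therefore ∑ |W_ij| |M_ij|, ready for Cauchy–Schwarz.
  set M : Matrix ι ι ℝ := U.transpose * (A - B) * V with hM
  have hMe : ∀ i j, M i j = (hA.eigenvalues i - hB.eigenvalues j) * W i j := by
    intro i j
    have : M = Matrix.diagonal hA.eigenvalues * W - W * Matrix.diagonal hB.eigenvalues := by
      rw [hM, Matrix.mul_sub, Matrix.sub_mul, hUA', Matrix.mul_assoc _ B, hVB]
      simp only [hW, Matrix.mul_assoc]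
    rw [this, Matrix.sub_apply, Matrix.diagonal_mul, Matrix.mul_diagonal]
    ring
  have hMF : ∑ i, ∑ j, M i j ^ 2 = ∑ i, ∑ j, (A i j - B i j) ^ 2 := by
    have h2 := sum_sq_entries_eq_trace (A - B)
    simp only [Matrix.sub_apply] at h2
    rw [sum_sq_entries_eq_trace, h2, hM]
    simp only [Matrix.transpose_mul, Matrix.transpose_transpose]
    rw [show V.transpose * ((A - B).transpose * U) * (U.transpose * (A - B) * V) =
      V.transpose * ((A - B).transpose * (U * U.transpose) * (A - B) * V) by
        simp only [Matrix.mul_assoc], hU2, Matrix.mul_one, Matrix.trace_mul_comm, Matrix.mul_assoc,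
        hV2, Matrix.mul_one]
  have e1 : ∑ i, Complex.exp ((t * hA.eigenvalues i : ℝ) * Complex.I) =
      ∑ i, ∑ j, ((W i j ^ 2 : ℝ) : ℂ) * Complex.exp ((t * hA.eigenvalues i : ℝ) * Complex.I) := by
    refine Finset.sum_congr rfl fun i _ => ?_
    rw [← Finset.sum_mul, ← Complex.ofReal_sum, hrow]; simp
  have e2 : ∑ j, Complex.exp ((t * hB.eigenvalues j : ℝ) * Complex.I) =
      ∑ i, ∑ j, ((W i j ^ 2 : ℝ) : ℂ) * Complex.exp ((t * hB.eigenvalues j : ℝ) * Complex.I) := by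
    rw [Finset.sum_comm]
    refine Finset.sum_congr rfl fun i _ => ?_
    rw [← Finset.sum_mul, ← Complex.ofReal_sum, hcol]; simp
  rw [e1, e2, ← Finset.sum_sub_distrib]
  simp_rw [← Finset.sum_sub_distrib, ← mul_sub]
  have hb : ∀ i j, ‖((W i j ^ 2 : ℝ) : ℂ) * (Complex.exp ((t * hA.eigenvalues i : ℝ) * Complex.I) -
      Complex.exp ((t * hB.eigenvalues j : ℝ) * Complex.I))‖ ≤ |t| * (|W i j| * |M i j|) := by
    intro i j
    rw [norm_mul, Complex.norm_real, Real.norm_eq_abs, abs_of_nonneg (sq_nonneg _)]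
    refine (mul_le_mul_of_nonneg_left (norm_exp_mul_I_sub_exp_mul_I_le _ _) (sq_nonneg _)).trans_eq ?_
    rw [← mul_sub, abs_mul, hMe, abs_mul, ← sq_abs]
    ring
  have hcs : ∑ i, ∑ j, |W i j| * |M i j| ≤
      √(Fintype.card ι * ∑ i, ∑ j, (A i j - B i j) ^ 2) := by
    refine Real.le_sqrt_of_sq_le ?_
    have := Finset.sum_mul_sq_le_sq_mul_sq (Finset.univ : Finset (ι × ι))
      (fun p => |W p.1 p.2|) (fun p => |M p.1 p.2|)
    simp only [sq_abs, Fintype.sum_prod_type] at this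
    rw [hMF] at this
    simpa [hrow] using this
  calc _ ≤ ∑ i, ∑ j, |t| * (|W i j| * |M i j|) :=
        (norm_sum_le _ _).trans (Finset.sum_le_sum fun i _ => (norm_sum_le _ _).trans
          (Finset.sum_le_sum fun j _ => hb i j))
    _ = |t| * ∑ i, ∑ j, |W i j| * |M i j| := by simp_rw [Finset.mul_sum]
    _ ≤ _ := mul_le_mul_of_nonneg_left hcs (abs_nonneg t)

end Spectral

/-! ### Palindromic Toeplitz matrices as bordered circulants -/

section Palindromic

/-- The symmetric circulant matrix of size `n`, bordered by a zero row and a zero column. -/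
def borderedCirculant (x : ℕ → ℝ) (n : ℕ) : Matrix (Fin (n + 1)) (Fin (n + 1)) ℝ :=
  Matrix.reindex finSumFinEquiv finSumFinEquiv
    (Matrix.fromBlocks (symCirculant x n) 0 0 (0 : Matrix (Fin 1) (Fin 1) ℝ))

lemma borderedCirculant_isHermitian (x : ℕ → ℝ) (n : ℕ) : (borderedCirculant x n).IsHermitian := by
  have h := symCirculant_isHermitian x n
  unfold borderedCirculant
  rw [Matrix.IsHermitian, Matrix.conjTranspose_reindex, Matrix.fromBlocks_conjTranspose, h.eq]
  simp

/-- The characteristic polynomial of a block diagonal matrix factors, so the border adds exactly one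
eigenvalue 0. -/
lemma borderedCirculant_eigenvalues {n : ℕ} (hn : 0 < n) (x : ℕ → ℝ)
    (hB : (borderedCirculant x n).IsHermitian) :
    (Finset.univ.val.map hB.eigenvalues : Multiset ℝ) =
      Finset.univ.val.map (Fin.snoc (fun k : Fin n => circEig x n k) 0 : Fin (n + 1) → ℝ) := by
  have hA := symCirculant_isHermitian x n
  have h1 : (borderedCirculant x n).charpoly =
      ∏ k : Fin (n + 1), (Polynomial.X - Polynomial.C ((Fin.snoc (fun k : Fin n => circEig x n k) 0 : Fin (n + 1) → ℝ) k)) := by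
    rw [borderedCirculant, Matrix.charpoly_reindex, Matrix.charpoly_fromBlocks_zero₁₂,
      Fin.prod_univ_castSucc, hA.charpoly_eq]
    congr 1
    · have := congrArg (fun s : Multiset ℝ => (s.map fun x => Polynomial.X - Polynomial.C x).prod)
        (symCirculant_eigenvalues hn x hA)
      simp only [Multiset.map_map, Function.comp_def] at this
      simp only [Fin.snoc_castSucc]
      exact this
    · simp [Matrix.charpoly, Matrix.charmatrix]
  rw [hB.charpoly_eq] at h1
  have h2 := congrArg Polynomial.roots h1
  rw [Polynomial.roots_prod _ _ (Finset.prod_ne_zero_iff.2 fun _ _ => Polynomial.X_sub_C_ne_zero _),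
    Polynomial.roots_prod _ _ (Finset.prod_ne_zero_iff.2 fun _ _ => Polynomial.X_sub_C_ne_zero _)] at h2
  simp only [Polynomial.roots_X_sub_C, Multiset.bind_singleton] at h2
  exact h2

lemma sum_sq_palindromicRow_le (x : ℕ → ℝ) (n : ℕ) :
    ∑ j ∈ Finset.range (n + 1), palindromicRow x (n + 1) j ^ 2 ≤
      2 * ∑ j ∈ Finset.range (n / 2 + 1), x j ^ 2 := by
  set y : ℕ → ℝ := fun j => if j < n / 2 + 1 then x j ^ 2 else 0 with hy
  have hy0 : ∀ j, 0 ≤ y j := fun j => by simp only [hy]; split_ifs <;> positivity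
  have h1 : ∀ j ∈ Finset.range (n + 1), palindromicRow x (n + 1) j ^ 2 ≤ y j + y (n + 1 - 1 - j) := by
    intro j hj
    rw [Finset.mem_range] at hj
    unfold palindromicRow
    split_ifs with h
    · refine le_add_of_le_of_nonneg ?_ (hy0 _)
      simp only [hy]; rw [if_pos (by omega)]
    · refine le_add_of_nonneg_of_le (hy0 _) ?_
      simp only [hy]; rw [if_pos (by omega)]
  have h2 : ∑ j ∈ Finset.range (n + 1), y j = ∑ j ∈ Finset.range (n / 2 + 1), x j ^ 2 := by
    rw [← Finset.sum_filter]
    congr 1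
    ext j; simp only [Finset.mem_filter, Finset.mem_range]; omega
  calc _ ≤ _ := Finset.sum_le_sum h1
    _ = _ := by rw [Finset.sum_add_distrib, Finset.sum_range_reflect y (n + 1), h2]; ring

/-- In size n + 1 the palindrome satisfies b_j = b_{n-j}, which is exactly the symmetry of a
circulant row of length n. Both rows switch to the reflected entries after index n / 2. -/
lemma palindromicToeplitz_castSucc (x : ℕ → ℝ) (n : ℕ) (i j : Fin n) :
    palindromicToeplitz x (n + 1) i.castSucc j.castSucc = symCirculant x n i j := by
  have hi := i.2
  have hj := j.2
  simp only [palindromicToeplitz, Matrix.of_apply, symCirculant, Matrix.circulant_apply,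
    palindromicRow, symCirculantRow, Fin.val_sub, Fin.val_castSucc]
  rcases lt_or_ge (i : ℕ) j with h | h
  · have e2 : (n - (j : ℕ) + i) % n = n - (j - i) := by
      rw [show n - (j : ℕ) + i = n - (j - i) by omega]
      exact Nat.mod_eq_of_lt (by omega)
    rw [e2, Nat.dist_eq_sub_of_le h.le]
    split_ifs <;> congr 1 <;> omega
  · have e2 : (n - (j : ℕ) + i) % n = i - j := by
      rw [show n - (j : ℕ) + i = (i - j) + n by omega, Nat.add_mod_right]
      exact Nat.mod_eq_of_lt (by omega)
    rw [e2, Nat.dist_eq_sub_of_le_right h]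
    split_ifs <;> congr 1 <;> omega

/-- A palindromic Toeplitz matrix is a circulant matrix up to its last row and column. -/
lemma sum_sq_palindromicToeplitz_sub_le (x : ℕ → ℝ) (n : ℕ) :
    ∑ i, ∑ j, (palindromicToeplitz x (n + 1) i j - borderedCirculant x n i j) ^ 2 ≤
      4 * ∑ j ∈ Finset.range (n / 2 + 1), x j ^ 2 := by
  set b : ℕ → ℝ := fun j => palindromicRow x (n + 1) j ^ 2 with hb
  have hb0 : ∀ j, 0 ≤ b j := fun j => sq_nonneg _
  have hin : ∀ i j : Fin n, borderedCirculant x n i.castSucc j.castSucc = symCirculant x n i j := by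
    intro i j
    have h : ∀ i : Fin n, finSumFinEquiv.symm (i.castSucc) = (Sum.inl i : Fin n ⊕ Fin 1) :=
      fun i => finSumFinEquiv_symm_apply_castAdd (n := 1) i
    simp [borderedCirculant, h]
  have hlast : finSumFinEquiv.symm (Fin.last n) = (Sum.inr 0 : Fin n ⊕ Fin 1) :=
    finSumFinEquiv_symm_last
  have hl1 : ∀ j, borderedCirculant x n (Fin.last n) j = 0 := by
    intro j
    simp only [borderedCirculant, Matrix.reindex_apply, Matrix.submatrix_apply, hlast]
    cases finSumFinEquiv.symm j <;> simp
  have hl2 : ∀ i, borderedCirculant x n i (Fin.last n) = 0 := by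
    intro i
    simp only [borderedCirculant, Matrix.reindex_apply, Matrix.submatrix_apply, hlast]
    cases finSumFinEquiv.symm i <;> simp
  have hsum := sum_sq_palindromicRow_le x n
  have hr : ∑ j : Fin (n + 1), b (n - j) = ∑ j ∈ Finset.range (n + 1), b j := by
    rw [← Finset.sum_range_reflect, Finset.sum_range]
    rfl
  have h1 : ∑ j : Fin (n + 1), (palindromicToeplitz x (n + 1) (Fin.last n) j -
      borderedCirculant x n (Fin.last n) j) ^ 2 = ∑ j ∈ Finset.range (n + 1), b j := by
    rw [← hr]
    refine Finset.sum_congr rfl fun j _ => ?_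
    rw [hl1, sub_zero]
    simp only [palindromicToeplitz, Matrix.of_apply, Fin.val_last, hb]
    rw [Nat.dist_eq_sub_of_le_right (by omega)]
  have h2 : ∑ i : Fin n, (palindromicToeplitz x (n + 1) i.castSucc (Fin.last n) -
      borderedCirculant x n i.castSucc (Fin.last n)) ^ 2 ≤ ∑ j ∈ Finset.range (n + 1), b j := by
    rw [← hr, Fin.sum_univ_castSucc]
    refine le_add_of_le_of_nonneg (Finset.sum_le_sum fun i _ => ?_) (hb0 _)
    rw [hl2, sub_zero]
    simp only [palindromicToeplitz, Matrix.of_apply, Fin.val_last, hb, Fin.val_castSucc]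
    rw [Nat.dist_eq_sub_of_le (by omega)]
  rw [Fin.sum_univ_castSucc, h1]
  have h3 : ∑ i : Fin n, ∑ j, (palindromicToeplitz x (n + 1) i.castSucc j -
      borderedCirculant x n i.castSucc j) ^ 2 ≤ ∑ j ∈ Finset.range (n + 1), b j := by
    refine le_trans (Finset.sum_le_sum fun i _ => ?_) h2
    rw [Fin.sum_univ_castSucc]
    simp [hin, palindromicToeplitz_castSucc]
  linarith

end Palindromic

/-! ### Stability of the circulant characteristic function -/

section CharFun

/-- The characteristic function at `t` of the uniform distribution on the eigenvalues of the
symmetric circulant matrix of size `n`. -/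
noncomputable def circCharFun (x : ℕ → ℝ) (n : ℕ) (t : ℝ) : ℂ :=
  (n : ℂ)⁻¹ * ∑ k ∈ Finset.range n, Complex.exp ((t * circEig x n k : ℝ) * Complex.I)

lemma circEig_const_mul (r : ℝ) (x : ℕ → ℝ) (n k : ℕ) :
    circEig (fun j => r * x j) n k = r * circEig x n k := by
  simp only [circEig, Finset.mul_sum]
  exact Finset.sum_congr rfl fun j _ => by ring

lemma smul_symCirculant (r : ℝ) (x : ℕ → ℝ) (n : ℕ) :
    r • symCirculant x n = symCirculant (fun j => r * x j) n := by
  ext i j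
  simp only [symCirculant, Matrix.smul_apply, Matrix.circulant_apply, symCirculantRow, smul_eq_mul]
  split_ifs <;> rfl

lemma smul_palindromicToeplitz (r : ℝ) (x : ℕ → ℝ) (n : ℕ) :
    r • palindromicToeplitz x n = palindromicToeplitz (fun j => r * x j) n := by
  ext i j
  simp only [palindromicToeplitz, Matrix.smul_apply, Matrix.of_apply, palindromicRow, smul_eq_mul]
  split_ifs <;> rfl

lemma charFun_spectralMeasure_symCirculant (x : ℕ → ℝ) (n : ℕ) (r t : ℝ)
    (h : (r • symCirculant x (n + 1)).IsHermitian) :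
    charFun (spectralMeasure (r • symCirculant x (n + 1)) h : Measure ℝ) t =
      circCharFun x (n + 1) (t * r) := by
  have h' := h
  rw [smul_symCirculant] at h'
  have e : spectralMeasure (r • symCirculant x (n + 1)) h =
      spectralMeasure (symCirculant (fun j => r * x j) (n + 1)) h' := by
    congr 1; exact smul_symCirculant _ _ _
  rw [e, charFun_spectralMeasure_eq_sum h' (symCirculant_eigenvalues n.succ_pos _ h'), circCharFun,
    Finset.sum_range]
  simp only [circEig_const_mul, Fintype.card_fin, mul_assoc]

/-- The comparison is with the bordered circulant, whose extra eigenvalue 0 contributes the summand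
1. When ∑ x_j² = O(n), the square root stays bounded, and r of order n^(-1/2) makes the error
vanish. -/
lemma norm_charFun_spectralMeasure_palindromicToeplitz_sub_le (x : ℕ → ℝ) {n : ℕ} (hn : 0 < n)
    (r t : ℝ) (h : (r • palindromicToeplitz x (n + 1)).IsHermitian) :
    ‖charFun (spectralMeasure (r • palindromicToeplitz x (n + 1)) h : Measure ℝ) t -
      ((n + 1 : ℕ) : ℂ)⁻¹ * (n * circCharFun x n (t * r) + 1)‖ ≤
    |t * r| * √(4 * (∑ j ∈ Finset.range (n / 2 + 1), x j ^ 2) / (n + 1 : ℕ)) := by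
  have h' := h
  rw [smul_palindromicToeplitz] at h'
  have e : spectralMeasure (r • palindromicToeplitz x (n + 1)) h =
      spectralMeasure (palindromicToeplitz (fun j => r * x j) (n + 1)) h' := by
    congr 1; exact smul_palindromicToeplitz _ _ _
  have hB := borderedCirculant_isHermitian (fun j => r * x j) n
  have e2 := charFun_spectralMeasure_eq_sum hB (borderedCirculant_eigenvalues hn _ hB) t
  have hn0 : (n : ℂ) ≠ 0 := by exact_mod_cast hn.ne'
  have e3 : ((n + 1 : ℕ) : ℂ)⁻¹ * (n * circCharFun x n (t * r) + 1) =
      charFun (spectralMeasure _ hB : Measure ℝ) t := by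
    rw [e2, Fin.sum_univ_castSucc, circCharFun, mul_inv_cancel_left₀ hn0, Finset.sum_range]
    simp [circEig_const_mul, mul_assoc]
  rw [e3, e, charFun_spectralMeasure, charFun_spectralMeasure, ← mul_sub, norm_mul]
  have hF := norm_sum_exp_eigenvalues_sub_le h' hB t
  have hS := sum_sq_palindromicToeplitz_sub_le (fun j => r * x j) n
  have hN : (0 : ℝ) < (n + 1 : ℕ) := by positivity
  have hc : ‖((Fintype.card (Fin (n + 1)) : ℕ) : ℂ)⁻¹‖ = ((n + 1 : ℕ) : ℝ)⁻¹ := by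
    rw [norm_inv, Fintype.card_fin, Complex.norm_natCast]
  rw [hc]
  refine (mul_le_mul_of_nonneg_left hF (by positivity)).trans ?_
  have hsq : √((Fintype.card (Fin (n + 1)) : ℝ) * ∑ i, ∑ j, (palindromicToeplitz (fun j => r * x j) (n + 1) i j -
        borderedCirculant (fun j => r * x j) n i j) ^ 2) ≤
      ((n + 1 : ℕ) : ℝ) * (|r| * √(4 * (∑ j ∈ Finset.range (n / 2 + 1), x j ^ 2) / (n + 1 : ℕ))) := by
    refine Real.sqrt_le_iff.2 ⟨by positivity, ?_⟩
    rw [mul_pow, mul_pow, Real.sq_sqrt (by positivity), sq_abs, Fintype.card_fin]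
    refine (mul_le_mul_of_nonneg_left hS hN.le).trans_eq ?_
    simp_rw [mul_pow]
    rw [← Finset.mul_sum]
    field_simp
  refine (mul_le_mul_of_nonneg_left (mul_le_mul_of_nonneg_left hsq (abs_nonneg t))
    (by positivity)).trans_eq ?_
  rw [abs_mul]
  field_simp

/-- The exponential is 1-Lipschitz on the imaginary axis; Cauchy–Schwarz over k and
`sum_sq_circEig_le` do the rest. Equal scales give the cost of truncation, equal rows the Lipschitz
bound in the argument. -/
lemma norm_circCharFun_sub_le {n : ℕ} (hn : 0 < n) (x y : ℕ → ℝ) (s t : ℝ) :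
    ‖circCharFun x n s - circCharFun y n t‖ ≤
      √(2 * ∑ j ∈ Finset.range (n / 2 + 1), (s * x j - t * y j) ^ 2) := by
  have hN : (0 : ℝ) < n := by exact_mod_cast hn
  rw [circCharFun, circCharFun, ← mul_sub, ← Finset.sum_sub_distrib, norm_mul, norm_inv,
    Complex.norm_natCast]
  have h1 : ‖∑ k ∈ Finset.range n, (Complex.exp ((s * circEig x n k : ℝ) * Complex.I) -
      Complex.exp ((t * circEig y n k : ℝ) * Complex.I))‖ ≤
      ∑ k ∈ Finset.range n, |circEig (fun j => s * x j - t * y j) n k| := by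
    refine (norm_sum_le _ _).trans (Finset.sum_le_sum fun k _ => ?_)
    refine (norm_exp_mul_I_sub_exp_mul_I_le _ _).trans_eq ?_
    rw [circEig_sub (fun j => s * x j), circEig_const_mul, circEig_const_mul]
  have h2 : ∑ k ∈ Finset.range n, |circEig (fun j => s * x j - t * y j) n k| ≤
      n * √(2 * ∑ j ∈ Finset.range (n / 2 + 1), (s * x j - t * y j) ^ 2) := by
    refine abs_le_of_sq_le_sq' ?_ (by positivity) |>.2
    rw [mul_pow, Real.sq_sqrt (by positivity)]
    have h3 := sum_sq_circEig_le hn (fun j => s * x j - t * y j)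
    have h4 := sq_sum_le_card_mul_sum_sq (s := Finset.range n)
      (f := fun k => |circEig (fun j => s * x j - t * y j) n k|)
    simp only [sq_abs, Finset.card_range] at h4
    refine h4.trans ((mul_le_mul_of_nonneg_left h3 hN.le).trans_eq ?_)
    ring
  refine (mul_le_mul_of_nonneg_left (h1.trans h2) (by positivity)).trans_eq ?_
  rw [inv_mul_cancel_left₀ hN.ne']

/-- Subtracting a constant from the row changes one eigenvalue only. -/
lemma norm_circCharFun_sub_const_sub_le {n : ℕ} (hn : 0 < n) (x : ℕ → ℝ) (m t : ℝ) :
    ‖circCharFun x n t - circCharFun (fun j => x j - m) n t‖ ≤ 2 / n := by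
  rw [circCharFun, circCharFun, ← mul_sub, ← Finset.sum_sub_distrib, norm_mul, norm_inv,
    Complex.norm_natCast, Finset.sum_eq_single_of_mem 0 (Finset.mem_range.2 hn)]
  · rw [inv_mul_eq_div]
    refine div_le_div_of_nonneg_right ((norm_sub_le _ _).trans ?_) (Nat.cast_nonneg n)
    rw [Complex.norm_exp_ofReal_mul_I, Complex.norm_exp_ofReal_mul_I]; norm_num
  · intro k hk hk0
    rw [circEig_sub x (fun _ => m), circEig_const (Nat.pos_of_ne_zero hk0) (Finset.mem_range.1 hk),
      sub_zero, sub_self]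

end CharFun

/-! ### Almost sure concentration from summable moments -/

section AlmostSure

variable {Ω : Type*} [MeasurableSpace Ω] {P : Measure Ω}

/-- Nonnegative random variables with summable expectations tend to zero almost surely. -/
lemma ae_tendsto_zero_of_summable_integral {V : ℕ → Ω → ℝ} (hV : ∀ k, Integrable (V k) P)
    (hV0 : ∀ k ω, 0 ≤ V k ω) {b : ℕ → ℝ} (hb : ∀ k, ∫ ω, V k ω ∂P ≤ b k) (hs : Summable b) :
    ∀ᵐ ω ∂P, Tendsto (fun k => V k ω) atTop (𝓝 0) := by
  have hm : ∀ k, AEMeasurable (fun ω => ENNReal.ofReal (V k ω)) P := fun k =>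
    (hV k).aemeasurable.ennreal_ofReal
  have h1 : ∫⁻ ω, ∑' k, ENNReal.ofReal (V k ω) ∂P ≠ ⊤ := by
    rw [lintegral_tsum hm]
    have h2 : ∀ k, ∫⁻ ω, ENNReal.ofReal (V k ω) ∂P ≤ ENNReal.ofReal (b k) := fun k => by
      rw [← ofReal_integral_eq_lintegral_ofReal (hV k) (ae_of_all _ (hV0 k))]
      exact ENNReal.ofReal_le_ofReal (hb k)
    have hb0 : ∀ k, 0 ≤ b k := fun k => (integral_nonneg (hV0 k)).trans (hb k)
    refine ne_top_of_le_ne_top ?_ (ENNReal.tsum_le_tsum h2)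
    rw [← ENNReal.ofReal_tsum_of_nonneg hb0 hs]
    exact ENNReal.ofReal_ne_top
  filter_upwards [ae_lt_top' (AEMeasurable.tsum hm) h1] with ω hω
  have h3 := ENNReal.tendsto_atTop_zero_of_tsum_ne_top hω.ne
  have h4 := (ENNReal.tendsto_toReal ENNReal.zero_ne_top).comp h3
  simpa [Function.comp_def, ENNReal.toReal_ofReal (hV0 _ ω)] using h4

/-- If the fourth central moments are summable, the random variables concentrate at their means. -/
lemma ae_tendsto_sub_of_summable_fourth_moment {Z : ℕ → Ω → ℝ} {e b : ℕ → ℝ}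
    (hZ : ∀ k, Integrable (fun ω => (Z k ω - e k) ^ 4) P)
    (hb : ∀ k, ∫ ω, (Z k ω - e k) ^ 4 ∂P ≤ b k) (hs : Summable b) :
    ∀ᵐ ω ∂P, Tendsto (fun k => Z k ω - e k) atTop (𝓝 0) := by
  filter_upwards [ae_tendsto_zero_of_summable_integral hZ (fun k ω => by positivity) hb hs] with ω hω
  rw [tendsto_zero_iff_abs_tendsto_zero]
  have h := (Real.continuous_sqrt.tendsto _).comp ((Real.continuous_sqrt.tendsto _).comp hω)
  simp only [Real.sqrt_zero] at h
  refine h.congr fun k => ?_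
  simp only [Function.comp_def]
  rw [show (Z k ω - e k) ^ 4 = ((Z k ω - e k) ^ 2) ^ 2 by ring, Real.sqrt_sq (sq_nonneg _),
    Real.sqrt_sq_eq_abs]

/-- The fourth moment bound for a function of the first `N` variables of an independent sequence. -/
lemma integral_pow_four_sub_le_of_iIndepFun [IsProbabilityMeasure P] {X : ℕ → Ω → ℝ}
    (hmeas : ∀ j, Measurable (X j)) (hindep : iIndepFun X P) {N : ℕ}
    {f : (Fin N → ℝ) → ℝ} (hf : Measurable f) {K : ℝ} (hK : ∀ x, |f x| ≤ K)
    (d : (Fin N → ℝ) → Fin N → ℝ) {v : ℝ}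
    (hd : ∀ x j y, (f x - f (Function.update x j y)) ^ 2 ≤ d x j) (hv : ∀ x, ∑ j, d x j ≤ v) :
    ∫ ω, (f (fun j => X j ω) - ∫ ω, f (fun j => X j ω) ∂P) ^ 4 ∂P ≤ 4 * v ^ 2 := by
  have hX : Measurable fun ω (j : Fin N) => X j ω := measurable_pi_iff.2 fun j => hmeas j
  have hmap := (iIndepFun_iff_map_fun_eq_pi_map (f := fun j : Fin N => X j) (μ := P)
    fun j => (hmeas j).aemeasurable).1 (hindep.precomp Fin.val_injective)
  have : ∀ j : Fin N, IsProbabilityMeasure (P.map (X j)) := fun j =>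
    Measure.isProbabilityMeasure_map (hmeas j).aemeasurable
  have h := integral_pow_four_sub_le (fun j : Fin N => P.map (X j)) hf hK d hd hv
  rw [← hmap, integral_map hX.aemeasurable hf.aestronglyMeasurable,
    integral_map hX.aemeasurable ((hf.sub_const _).pow_const 4).aestronglyMeasurable] at h
  exact h

/-- The truncation level for the first `n` variables. -/
noncomputable def truncLevel (n : ℕ) : ℝ := (n : ℝ) ^ (1 / 16 : ℝ)

/-- The exponent 1/16 is a convenience: concentration needs C⁸/n² summable and the mean estimate
needs C³/√n → 0. With C¹⁶ = n, all errors become integer powers of C. -/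
lemma truncLevel_pow (n : ℕ) : truncLevel n ^ 16 = n := by
  rw [truncLevel, ← Real.rpow_natCast, ← Real.rpow_mul (Nat.cast_nonneg n)]
  norm_num

lemma truncLevel_nonneg (n : ℕ) : 0 ≤ truncLevel n := Real.rpow_nonneg (Nat.cast_nonneg n) _

lemma truncLevel_mono {m n : ℕ} (h : m ≤ n) : truncLevel m ≤ truncLevel n :=
  Real.rpow_le_rpow (Nat.cast_nonneg m) (by exact_mod_cast h) (by norm_num)

lemma one_le_truncLevel {n : ℕ} (hn : 0 < n) : 1 ≤ truncLevel n :=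
  Real.one_le_rpow (by exact_mod_cast hn) (by norm_num)

lemma tendsto_truncLevel : Tendsto truncLevel atTop atTop :=
  (tendsto_rpow_atTop (by norm_num)).comp tendsto_natCast_atTop_atTop

lemma truncLevel_pow_eight (n : ℕ) : truncLevel n ^ 8 = √(n : ℝ) := by
  rw [← truncLevel_pow n, show truncLevel n ^ 16 = (truncLevel n ^ 8) ^ 2 by ring,
    Real.sqrt_sq (pow_nonneg (truncLevel_nonneg n) 8)]

lemma truncLevel_two_pow (k : ℕ) : truncLevel (2 ^ k) = truncLevel 2 ^ k := by
  rw [truncLevel, truncLevel, ← Real.rpow_natCast, ← Real.rpow_mul (by positivity), mul_comm,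
    Real.rpow_mul (by positivity)]
  simp

lemma summable_truncLevel_pow_div : Summable fun n : ℕ => truncLevel n ^ 8 / (n : ℝ) ^ 2 := by
  refine (Real.summable_nat_rpow_inv (p := 3 / 2) |>.2 (by norm_num)).congr fun n => ?_
  rcases Nat.eq_zero_or_pos n with rfl | hn
  · norm_num
  · have hn' : (0 : ℝ) < n := by exact_mod_cast hn
    rw [truncLevel_pow_eight, Real.sqrt_eq_rpow, ← Real.rpow_natCast, ← Real.rpow_sub hn',
      ← Real.rpow_neg hn'.le]
    norm_num

/-- Concentration of functions of the first variables of an independent sequence. -/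
lemma ae_tendsto_sub_integral_of_efron_stein [IsProbabilityMeasure P] {X : ℕ → Ω → ℝ}
    (hmeas : ∀ j, Measurable (X j)) (hindep : iIndepFun X P) (N : ℕ → ℕ)
    (f : (n : ℕ) → (Fin (N n) → ℝ) → ℝ) (hf : ∀ n, Measurable (f n)) (K : ℕ → ℝ)
    (hK : ∀ n x, |f n x| ≤ K n) (d : (n : ℕ) → (Fin (N n) → ℝ) → Fin (N n) → ℝ) {c : ℝ}
    (hd : ∀ n x j y, (f n x - f n (Function.update x j y)) ^ 2 ≤ d n x j)
    (hv : ∀ n x, ∑ j, d n x j ≤ c * (truncLevel n ^ 4 / n)) :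
    ∀ᵐ ω ∂P, Tendsto (fun n => f n (fun j => X j ω) - ∫ ω, f n (fun j => X j ω) ∂P) atTop (𝓝 0) := by
  refine ae_tendsto_sub_of_summable_fourth_moment (b := fun n => 4 * (c * (truncLevel n ^ 4 / n)) ^ 2)
    (fun n => ?_) (fun n => integral_pow_four_sub_le_of_iIndepFun hmeas hindep (hf n) (hK n) (d n)
      (hd n) (hv n)) ?_
  · have hX : Measurable fun ω (j : Fin (N n)) => X j ω := measurable_pi_iff.2 fun j => hmeas j
    refine integrable_of_measurable_of_abs_le (K := (2 * K n) ^ 4)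
      ((((hf n).comp hX).sub_const _).pow_const 4) fun ω => ?_
    rw [abs_pow]
    refine pow_le_pow_left₀ (abs_nonneg _) ((abs_sub _ _).trans ?_) 4
    rw [two_mul]
    exact add_le_add (hK n _) (abs_integral_le_of_abs_le fun _ => hK n _)
  · refine (summable_truncLevel_pow_div.mul_left (4 * c ^ 2)).congr fun n => ?_
    ring

end AlmostSure

/-! ### Truncation under a third moment bound -/

section Truncation

/-- The truncation of a real number at level `C`. -/
noncomputable def clip (C y : ℝ) : ℝ := if |y| ≤ C then y else 0

lemma measurable_clip (C : ℝ) : Measurable (clip C) :=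
  Measurable.ite (measurableSet_le measurable_norm measurable_const) measurable_id measurable_const

lemma abs_clip_le {C : ℝ} (hC : 0 ≤ C) (y : ℝ) : |clip C y| ≤ C := by
  unfold clip; split_ifs with h
  · exact h
  · simpa using hC

/-- The left side is nonzero only where |y| > C, and there the factor (|y|/C)² exceeds 1. -/
lemma abs_sub_clip_le {C : ℝ} (hC : 0 < C) (y : ℝ) : |y - clip C y| ≤ |y| ^ 3 / C ^ 2 := by
  unfold clip; split_ifs with h
  · simp; positivity
  · rw [sub_zero, le_div_iff₀ (by positivity)]
    push Not at h
    nlinarith [mul_le_mul_of_nonneg_left (mul_le_mul h.le h.le hC.le (abs_nonneg y)) (abs_nonneg y)]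

lemma sq_sub_clip_le {C : ℝ} (hC : 0 < C) (y : ℝ) : (y - clip C y) ^ 2 ≤ |y| ^ 3 / C := by
  unfold clip; split_ifs with h
  · simp; positivity
  · rw [sub_zero, le_div_iff₀ hC, ← sq_abs]
    push Not at h
    nlinarith [mul_le_mul_of_nonneg_left h.le (sq_nonneg |y|)]

/-- A truncated value is either y or 0, so the cross term between kept and discarded parts vanishes.
-/
lemma sq_sub_sq_clip (C y : ℝ) : y ^ 2 - clip C y ^ 2 = (y - clip C y) ^ 2 := by
  unfold clip; split_ifs <;> ring

/-- This monotonicity allows the level at n to be lowered to the level at the preceding power of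
two. -/
lemma sq_sub_clip_le_of_le {C D : ℝ} (h : C ≤ D) (y : ℝ) : (y - clip D y) ^ 2 ≤ (y - clip C y) ^ 2 := by
  unfold clip
  split_ifs with h1 h2 h2
  · simp
  · simp; positivity
  · exact absurd (h2.trans h) h1
  · simp

variable {Ω : Type*} [MeasurableSpace Ω] {P : Measure Ω} [IsProbabilityMeasure P] {Y : Ω → ℝ}

lemma integrable_of_integrable_abs_pow_three (hY : Measurable Y)
    (hi : Integrable (fun ω => |Y ω| ^ 3) P) : Integrable Y P := by
  refine ((integrable_const 1).add hi).mono' hY.aestronglyMeasurable (ae_of_all _ fun ω => ?_)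
  simp only [Pi.add_apply, Real.norm_eq_abs]
  have := abs_nonneg (Y ω)
  nlinarith [mul_nonneg this (sq_nonneg (|Y ω| - 1))]

lemma integrable_sq_of_integrable_abs_pow_three (hY : Measurable Y)
    (hi : Integrable (fun ω => |Y ω| ^ 3) P) : Integrable (fun ω => Y ω ^ 2) P := by
  refine ((integrable_const 1).add hi).mono' (hY.pow_const 2).aestronglyMeasurable
    (ae_of_all _ fun ω => ?_)
  simp only [Pi.add_apply, Real.norm_eq_abs, abs_pow]
  have := abs_nonneg (Y ω)
  nlinarith [mul_nonneg this (sq_nonneg (|Y ω| - 1)), sq_nonneg (|Y ω| - 1)]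

lemma integrable_clip {C : ℝ} (hC : 0 ≤ C) (hY : Measurable Y) : Integrable (fun ω => clip C (Y ω)) P :=
  integrable_of_measurable_of_abs_le ((measurable_clip C).comp hY) fun _ => abs_clip_le hC _

lemma integrable_sq_clip {C : ℝ} (hC : 0 ≤ C) (hY : Measurable Y) :
    Integrable (fun ω => clip C (Y ω) ^ 2) P :=
  integrable_of_measurable_of_abs_le (((measurable_clip C).comp hY).pow_const 2) (K := C ^ 2)
    fun _ => by rw [abs_pow]; exact pow_le_pow_left₀ (abs_nonneg _) (abs_clip_le hC _) 2

lemma integrable_sq_sub_clip {C : ℝ} (hC : 0 < C) (hY : Measurable Y)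
    (hi : Integrable (fun ω => |Y ω| ^ 3) P) : Integrable (fun ω => (Y ω - clip C (Y ω)) ^ 2) P := by
  simp only [← sq_sub_sq_clip]
  exact (integrable_sq_of_integrable_abs_pow_three hY hi).sub (integrable_sq_clip hC.le hY)

lemma integral_sq_sub_clip_le {C M : ℝ} (hC : 0 < C) (hY : Measurable Y)
    (hi : Integrable (fun ω => |Y ω| ^ 3) P) (hM : ∫ ω, |Y ω| ^ 3 ∂P ≤ M) :
    ∫ ω, (Y ω - clip C (Y ω)) ^ 2 ∂P ≤ M / C := by
  refine (integral_mono (integrable_sq_sub_clip hC hY hi) (hi.div_const C)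
    fun ω => sq_sub_clip_le hC _).trans ?_
  rw [integral_div]
  exact div_le_div_of_nonneg_right hM hC.le

lemma abs_integral_clip_le {C M : ℝ} (hC : 0 < C) (hY : Measurable Y)
    (hi : Integrable (fun ω => |Y ω| ^ 3) P) (hM : ∫ ω, |Y ω| ^ 3 ∂P ≤ M) (h0 : ∫ ω, Y ω ∂P = 0) :
    |∫ ω, clip C (Y ω) ∂P| ≤ M / C ^ 2 := by
  have h1 : ∫ ω, clip C (Y ω) ∂P = - ∫ ω, (Y ω - clip C (Y ω)) ∂P := by
    rw [integral_sub (integrable_of_integrable_abs_pow_three hY hi) (integrable_clip hC.le hY), h0]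
    ring
  rw [h1, abs_neg]
  refine (abs_integral_le_integral_abs).trans ?_
  refine (integral_mono ((integrable_of_integrable_abs_pow_three hY hi).sub
    (integrable_clip hC.le hY)).abs (hi.div_const (C ^ 2)) fun ω => abs_sub_clip_le hC _).trans ?_
  rw [integral_div]
  exact div_le_div_of_nonneg_right hM (by positivity)

/-- The variance of a truncated centred variable is close to the variance. -/
lemma abs_integral_sq_centred_clip_sub_le {C M v : ℝ} (hC : 0 < C) (hY : Measurable Y)
    (hi : Integrable (fun ω => |Y ω| ^ 3) P) (hM : ∫ ω, |Y ω| ^ 3 ∂P ≤ M) (h0 : ∫ ω, Y ω ∂P = 0)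
    (h2 : ∫ ω, Y ω ^ 2 ∂P = v) :
    |∫ ω, (clip C (Y ω) - ∫ ω, clip C (Y ω) ∂P) ^ 2 ∂P - v| ≤ M / C + (M / C ^ 2) ^ 2 := by
  set a := ∫ ω, clip C (Y ω) ∂P with ha
  have h1 : ∫ ω, (clip C (Y ω) - a) ^ 2 ∂P = ∫ ω, clip C (Y ω) ^ 2 ∂P - a ^ 2 := by
    have h3 : ∀ ω, (clip C (Y ω) - a) ^ 2 = clip C (Y ω) ^ 2 - 2 * a * clip C (Y ω) + a ^ 2 :=
      fun ω => by ring
    have e1 : Integrable (fun ω => 2 * a * clip C (Y ω)) P := (integrable_clip hC.le hY).const_mul _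
    have e2 : Integrable (fun ω => clip C (Y ω) ^ 2 - 2 * a * clip C (Y ω)) P :=
      (integrable_sq_clip hC.le hY).sub e1
    simp_rw [h3]
    rw [integral_add e2 (integrable_const _), integral_sub (integrable_sq_clip hC.le hY) e1,
      integral_const_mul, ← ha]
    simp; ring
  have h4 : v - ∫ ω, clip C (Y ω) ^ 2 ∂P = ∫ ω, (Y ω - clip C (Y ω)) ^ 2 ∂P := by
    rw [← h2, ← integral_sub (integrable_sq_of_integrable_abs_pow_three hY hi)
      (integrable_sq_clip hC.le hY)]
    simp only [sq_sub_sq_clip]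
  have h5 := integral_sq_sub_clip_le hC hY hi hM
  have h6 : 0 ≤ ∫ ω, (Y ω - clip C (Y ω)) ^ 2 ∂P := integral_nonneg fun _ => sq_nonneg _
  have h7 : a ^ 2 ≤ (M / C ^ 2) ^ 2 := sq_le_sq.2 ((abs_integral_clip_le hC hY hi hM h0).trans
    (le_abs_self _))
  rw [h1, abs_le]
  constructor <;> nlinarith [sq_nonneg a]

end Truncation

/-! ### Concentration of circulant eigenvalue statistics -/

section Concentration

/-- The bound holds for all real d: for |d| > 1 the left side is at most 2|d| ≤ 2d². -/
lemma norm_exp_mul_I_sub_one_sub_le (d : ℝ) :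
    ‖Complex.exp (d * Complex.I) - 1 - d * Complex.I‖ ≤ 2 * d ^ 2 := by
  rcases le_or_gt |d| 1 with h | h
  · have h1 : ‖(d : ℂ) * Complex.I‖ = |d| := by simp
    have := Complex.norm_exp_sub_one_sub_id_le (x := d * Complex.I) (h1.le.trans h)
    rw [h1, sq_abs] at this
    nlinarith [sq_nonneg d]
  · have h1 := norm_exp_mul_I_sub_exp_mul_I_le d 0
    simp only [Complex.ofReal_zero, zero_mul, Complex.exp_zero, sub_zero] at h1
    refine (norm_sub_le _ _).trans ?_
    have h2 : ‖(d : ℂ) * Complex.I‖ = |d| := by simp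
    rw [h2]
    nlinarith [sq_abs d]

lemma norm_exp_mul_I_taylor_le (u d : ℝ) :
    ‖Complex.exp ((u + d : ℝ) * Complex.I) - Complex.exp (u * Complex.I) -
      d * (Complex.I * Complex.exp (u * Complex.I))‖ ≤ 2 * d ^ 2 := by
  have e : Complex.exp ((u + d : ℝ) * Complex.I) - Complex.exp (u * Complex.I) -
      d * (Complex.I * Complex.exp (u * Complex.I)) =
      Complex.exp (u * Complex.I) * (Complex.exp (d * Complex.I) - 1 - d * Complex.I) := by
    rw [Complex.ofReal_add, add_mul, Complex.exp_add]; ring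
  rw [e, norm_mul, Complex.norm_exp_ofReal_mul_I, one_mul]
  exact norm_exp_mul_I_sub_one_sub_le d

/-- The pairs (cos, -sin) and (sin, cos) are the pairs (g, h) of a function and its derivative used
for the real and imaginary parts of φ_n. -/
lemma abs_cos_taylor_le (u d : ℝ) : |Real.cos (u + d) - Real.cos u - d * (-Real.sin u)| ≤ 2 * d ^ 2 := by
  have := (Complex.abs_re_le_norm _).trans (norm_exp_mul_I_taylor_le u d)
  simpa only [Complex.sub_re, Complex.exp_ofReal_mul_I_re, Complex.re_ofReal_mul, Complex.I_mul_re,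
    Complex.exp_ofReal_mul_I_im] using this

lemma abs_sin_taylor_le (u d : ℝ) : |Real.sin (u + d) - Real.sin u - d * Real.cos u| ≤ 2 * d ^ 2 := by
  have := (Complex.abs_im_le_norm _).trans (norm_exp_mul_I_taylor_le u d)
  simpa only [Complex.sub_im, Complex.exp_ofReal_mul_I_re, Complex.im_ofReal_mul, Complex.I_mul_im,
    Complex.exp_ofReal_mul_I_im] using this

/-- The sensitivity of a linear eigenvalue statistic of a circulant matrix to its `j`-th variable. -/
lemma sq_circulant_statistic_sub_le {n : ℕ} (hn : 0 < n) {g h : ℝ → ℝ}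
    (hgh : ∀ u d, |g (u + d) - g u - d * h u| ≤ 2 * d ^ 2) (s : ℝ)
    (T : ℕ → ℝ → ℝ) {D : ℝ} (hT : ∀ j y z, |T j y - T j z| ≤ D) (x : Fin (n / 2 + 1) → ℝ)
    (j : Fin (n / 2 + 1)) (y : ℝ) :
    ((n : ℝ)⁻¹ * ∑ k ∈ Finset.range n, g (s * ∑ i : Fin (n / 2 + 1), circCoeff n i k * T i (x i)) -
      (n : ℝ)⁻¹ * ∑ k ∈ Finset.range n,
        g (s * ∑ i : Fin (n / 2 + 1), circCoeff n i k * T i (Function.update x j y i))) ^ 2 ≤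
    2 * s ^ 2 * D ^ 2 * ((n : ℝ)⁻¹ * ∑ k ∈ Finset.range n,
      h (s * ∑ i : Fin (n / 2 + 1), circCoeff n i k * T i (x i)) * circCoeff n j k) ^ 2 +
      128 * s ^ 4 * D ^ 4 := by
  have hN : (0 : ℝ) < n := by exact_mod_cast hn
  set u : ℕ → ℝ := fun k => s * ∑ i : Fin (n / 2 + 1), circCoeff n i k * T i (x i) with hu
  set Δ := T j y - T j (x j) with hΔ
  have hD : |Δ| ≤ D := hT _ _ _
  have hupd : ∀ k, s * ∑ i : Fin (n / 2 + 1), circCoeff n i k * T i (Function.update x j y i) =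
      u k + s * circCoeff n j k * Δ := by
    intro k
    have : ∑ i : Fin (n / 2 + 1), circCoeff n i k * T i (Function.update x j y i) -
        ∑ i : Fin (n / 2 + 1), circCoeff n i k * T i (x i) = circCoeff n j k * Δ := by
      rw [← Finset.sum_sub_distrib, Finset.sum_eq_single j]
      · rw [Function.update_self, hΔ]; ring
      · intro i _ hij
        rw [Function.update_of_ne hij, sub_self]
      · simp
    rw [hu, mul_assoc, ← this]; ring
  simp_rw [hupd]
  set r : ℕ → ℝ := fun k => g (u k + s * circCoeff n j k * Δ) - g (u k) -
    (s * circCoeff n j k * Δ) * h (u k) with hr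
  set A := (n : ℝ)⁻¹ * ∑ k ∈ Finset.range n, h (u k) * circCoeff n j k with hA
  -- The Taylor remainder is at most 2(s c Δ)² with |c| ≤ 2 and |Δ| ≤ D. Squaring, with (a + b)² ≤
  -- 2a² + 2b², yields the constant 128 = 2 · 8².
  have hrk : ∀ k, |r k| ≤ 8 * s ^ 2 * D ^ 2 := by
    intro k
    refine (hgh _ _).trans ?_
    have h1 : circCoeff n j k ^ 2 ≤ 2 ^ 2 := sq_le_sq.2 ((abs_circCoeff_le _ _ _).trans (le_abs_self 2))
    have h2 : Δ ^ 2 ≤ D ^ 2 := sq_le_sq.2 (hD.trans (le_abs_self D))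
    have h3 := mul_le_mul h1 h2 (sq_nonneg _) (by norm_num)
    have h4 := mul_le_mul_of_nonneg_left h3 (sq_nonneg s)
    nlinarith
  have hR : |(n : ℝ)⁻¹ * ∑ k ∈ Finset.range n, r k| ≤ 8 * s ^ 2 * D ^ 2 := by
    rw [abs_mul, abs_of_pos (inv_pos.2 hN), inv_mul_le_iff₀ hN]
    refine (Finset.abs_sum_le_sum_abs _ _).trans ((Finset.sum_le_card_nsmul _ _ _ fun k _ => hrk k).trans_eq ?_)
    simp
  have hdiff : (n : ℝ)⁻¹ * ∑ k ∈ Finset.range n, g (u k) -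
      (n : ℝ)⁻¹ * ∑ k ∈ Finset.range n, g (u k + s * circCoeff n j k * Δ) =
      -(s * Δ * A) - (n : ℝ)⁻¹ * ∑ k ∈ Finset.range n, r k := by
    have h1 : ∑ k ∈ Finset.range n, g (u k + s * circCoeff n j k * Δ) = ∑ k ∈ Finset.range n, g (u k) +
        s * Δ * ∑ k ∈ Finset.range n, h (u k) * circCoeff n j k + ∑ k ∈ Finset.range n, r k := by
      rw [Finset.mul_sum, ← Finset.sum_add_distrib, ← Finset.sum_add_distrib]
      exact Finset.sum_congr rfl fun k _ => by simp only [hr]; ring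
    rw [h1, hA]; ring
  rw [hdiff]
  set R := (n : ℝ)⁻¹ * ∑ k ∈ Finset.range n, r k
  have h2 : Δ ^ 2 ≤ D ^ 2 := sq_le_sq.2 (hD.trans (le_abs_self D))
  have hR2 : R ^ 2 ≤ (8 * s ^ 2 * D ^ 2) ^ 2 := sq_le_sq.2 (hR.trans (le_abs_self _))
  have h3 : (s * Δ * A) ^ 2 ≤ s ^ 2 * D ^ 2 * A ^ 2 := by
    rw [mul_pow, mul_pow]
    exact mul_le_mul_of_nonneg_right (mul_le_mul_of_nonneg_left h2 (sq_nonneg s)) (sq_nonneg A)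
  nlinarith [sq_nonneg (s * Δ * A - R)]

/-- Bessel's inequality bounds the sum over j of the squared averages by 4n·n/n² = 4; a termwise
bound would lose a factor of order n. The second-order terms are already small enough to be added
over at most n coordinates. -/
lemma sum_sensitivity_le {n : ℕ} (hn : 0 < n) {w : ℕ → ℝ} (hw : ∀ k, |w k| ≤ 1) (s D : ℝ) :
    ∑ j : Fin (n / 2 + 1), (2 * s ^ 2 * D ^ 2 * ((n : ℝ)⁻¹ * ∑ k ∈ Finset.range n,
      w k * circCoeff n j k) ^ 2 + 128 * s ^ 4 * D ^ 4) ≤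
    8 * s ^ 2 * D ^ 2 + 128 * n * s ^ 4 * D ^ 4 := by
  have hN : (0 : ℝ) < n := by exact_mod_cast hn
  have h1 := sum_sq_sum_circCoeff_le hn w
  have h2 : ∑ k ∈ Finset.range n, w k ^ 2 ≤ n := by
    refine (Finset.sum_le_card_nsmul _ _ 1 fun k _ => ?_).trans_eq (by simp)
    rw [← sq_abs]; exact pow_le_one₀ (abs_nonneg _) (hw k)
  rw [Finset.sum_range] at h1
  have h3 : ∑ j : Fin (n / 2 + 1), ((n : ℝ)⁻¹ * ∑ k ∈ Finset.range n, w k * circCoeff n j k) ^ 2 ≤ 4 := by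
    simp_rw [mul_pow]
    rw [← Finset.mul_sum, inv_pow, inv_mul_le_iff₀ (by positivity)]
    nlinarith
  rw [Finset.sum_add_distrib, ← Finset.mul_sum, Finset.sum_const, Finset.card_univ, Fintype.card_fin,
    nsmul_eq_mul]
  have h4 : ((n / 2 + 1 : ℕ) : ℝ) ≤ n := by exact_mod_cast (show n / 2 + 1 ≤ n by omega)
  have h5 := mul_le_mul_of_nonneg_left h3 (show 0 ≤ 2 * s ^ 2 * D ^ 2 by positivity)
  have h6 := mul_le_mul_of_nonneg_right h4 (show 0 ≤ 128 * s ^ 4 * D ^ 4 by positivity)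
  nlinarith

variable {Ω : Type*} [MeasurableSpace Ω] {P : Measure Ω} [IsProbabilityMeasure P] {X : ℕ → Ω → ℝ}

/-- Concentration of bounded trigonometric eigenvalue statistics of truncated circulant matrices. -/
lemma ae_tendsto_circulant_statistic_sub (hmeas : ∀ j, Measurable (X j)) (hindep : iIndepFun X P)
    {g h : ℝ → ℝ} (hg : Measurable g) (hg1 : ∀ u, |g u| ≤ 1) (hh1 : ∀ u, |h u| ≤ 1)
    (hgh : ∀ u d, |g (u + d) - g u - d * h u| ≤ 2 * d ^ 2)
    (T : ℕ → ℕ → ℝ → ℝ) (hTm : ∀ n j, Measurable (T n j))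
    (hT : ∀ n j y z, |T n j y - T n j z| ≤ 2 * truncLevel n) (t : ℝ) :
    ∀ᵐ ω ∂P, Tendsto (fun n : ℕ =>
      (n : ℝ)⁻¹ * ∑ k ∈ Finset.range n, g (t / √(n : ℝ) * circEig (fun j => T n j (X j ω)) n k) -
      ∫ ω, (n : ℝ)⁻¹ * ∑ k ∈ Finset.range n,
        g (t / √(n : ℝ) * circEig (fun j => T n j (X j ω)) n k) ∂P) atTop (𝓝 0) := by
  have hconv : ∀ (n k : ℕ) ω, circEig (fun j => T n j (X j ω)) n k =
      ∑ i : Fin (n / 2 + 1), circCoeff n i k * T n i (X i ω) := fun n k ω => by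
    rw [circEig, Finset.sum_range]
  simp_rw [hconv]
  refine ae_tendsto_sub_integral_of_efron_stein hmeas hindep (fun n => n / 2 + 1)
    (fun n x => (n : ℝ)⁻¹ * ∑ k ∈ Finset.range n,
      g (t / √(n : ℝ) * ∑ i : Fin (n / 2 + 1), circCoeff n i k * T n i (x i))) (fun n => ?_)
    (fun _ => 1) (fun n x => ?_)
    (fun n x j => 2 * (t / √(n : ℝ)) ^ 2 * (2 * truncLevel n) ^ 2 * ((n : ℝ)⁻¹ * ∑ k ∈ Finset.range n,
      h (t / √(n : ℝ) * ∑ i : Fin (n / 2 + 1), circCoeff n i k * T n i (x i)) * circCoeff n j k) ^ 2 +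
      128 * (t / √(n : ℝ)) ^ 4 * (2 * truncLevel n) ^ 4) (c := 32 * t ^ 2 + 2048 * t ^ 4)
    (fun n x j y => ?_) (fun n x => ?_)
  · have hi : ∀ i : Fin (n / 2 + 1), Measurable fun x : Fin (n / 2 + 1) → ℝ => T n i (x i) :=
      fun i => (hTm n i).comp (measurable_pi_apply i)
    fun_prop
  · rcases Nat.eq_zero_or_pos n with rfl | hn
    · simp
    · have hN : (0 : ℝ) < n := by exact_mod_cast hn
      rw [abs_mul, abs_of_pos (inv_pos.2 hN), inv_mul_le_iff₀ hN]
      refine (Finset.abs_sum_le_sum_abs _ _).trans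
        ((Finset.sum_le_card_nsmul _ _ 1 fun k _ => hg1 _).trans_eq ?_)
      simp
  · rcases Nat.eq_zero_or_pos n with rfl | hn
    · simp
    · exact sq_circulant_statistic_sub_le hn hgh _ (T n) (hT n) x j y
  · rcases Nat.eq_zero_or_pos n with rfl | hn
    · simp
    · have hN : (0 : ℝ) < n := by exact_mod_cast hn
      refine (sum_sensitivity_le hn (fun k => hh1 _) _ _).trans ?_
      have h1 : (t / √(n : ℝ)) ^ 2 = t ^ 2 / n := by rw [div_pow, Real.sq_sqrt hN.le]
      have h2 : (t / √(n : ℝ)) ^ 4 = t ^ 4 / n ^ 2 := by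
        rw [div_pow, show √(n : ℝ) ^ 4 = (√(n : ℝ) ^ 2) ^ 2 by ring, Real.sq_sqrt hN.le]
      rw [h1, h2]
      have hC := one_le_truncLevel hn
      have h3 : truncLevel n ^ 2 ≤ truncLevel n ^ 4 := pow_le_pow_right₀ hC (by norm_num)
      calc _ = (32 * t ^ 2 * truncLevel n ^ 2 + 2048 * t ^ 4 * truncLevel n ^ 4) / n := by
            field_simp; ring
        _ ≤ (32 * t ^ 2 * truncLevel n ^ 4 + 2048 * t ^ 4 * truncLevel n ^ 4) / n := by
            gcongr
        _ = _ := by ring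

/-- Concentration of the empirical second moment of truncated variables. -/
lemma ae_tendsto_sum_sq_clip_sub (hmeas : ∀ j, Measurable (X j)) (hindep : iIndepFun X P) :
    ∀ᵐ ω ∂P, Tendsto (fun n : ℕ =>
      (n : ℝ)⁻¹ * ∑ j ∈ Finset.range (n / 2 + 1), clip (truncLevel n) (X j ω) ^ 2 -
      ∫ ω, (n : ℝ)⁻¹ * ∑ j ∈ Finset.range (n / 2 + 1), clip (truncLevel n) (X j ω) ^ 2 ∂P)
      atTop (𝓝 0) := by
  have hc : ∀ n y, clip (truncLevel n) y ^ 2 ≤ truncLevel n ^ 2 := fun n y =>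
    sq_le_sq.2 ((abs_clip_le (truncLevel_nonneg n) y).trans (le_abs_self _))
  have h4 : ∀ n, 0 < n → ((n / 2 + 1 : ℕ) : ℝ) ≤ n := fun n hn => by
    exact_mod_cast (show n / 2 + 1 ≤ n by omega)
  simp_rw [Finset.sum_range]
  refine ae_tendsto_sub_integral_of_efron_stein hmeas hindep (fun n => n / 2 + 1)
    (fun n x => (n : ℝ)⁻¹ * ∑ j : Fin (n / 2 + 1), clip (truncLevel n) (x j) ^ 2) (fun n => ?_)
    (fun n => truncLevel n ^ 2) (fun n x => ?_) (fun n _ _ => ((n : ℝ)⁻¹ * truncLevel n ^ 2) ^ 2)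
    (c := 1) (fun n x j y => ?_) (fun n x => ?_)
  · exact (Finset.measurable_sum _ fun j _ =>
      ((measurable_clip _).comp (measurable_pi_apply j)).pow_const 2).const_mul _
  · rcases Nat.eq_zero_or_pos n with rfl | hn
    · simp; positivity
    · have hN : (0 : ℝ) < n := by exact_mod_cast hn
      rw [abs_of_nonneg (by positivity), inv_mul_le_iff₀ hN]
      refine (Finset.sum_le_card_nsmul _ _ (truncLevel n ^ 2) fun k _ => hc n _).trans ?_
      rw [Finset.card_univ, Fintype.card_fin, nsmul_eq_mul]
      exact mul_le_mul_of_nonneg_right (h4 n hn) (sq_nonneg _)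
  · rw [← mul_sub, ← Finset.sum_sub_distrib, Finset.sum_eq_single j]
    · rw [Function.update_self, mul_pow, mul_pow]
      refine mul_le_mul_of_nonneg_left ?_ (sq_nonneg _)
      refine sq_le_sq' ?_ ?_
      · nlinarith [hc n y, sq_nonneg (clip (truncLevel n) (x j))]
      · nlinarith [hc n (x j), sq_nonneg (clip (truncLevel n) y)]
    · intro i _ hij
      rw [Function.update_of_ne hij, sub_self]
    · simp
  · rcases Nat.eq_zero_or_pos n with rfl | hn
    · simp
    · have hN : (0 : ℝ) < n := by exact_mod_cast hn
      rw [Finset.sum_const, Finset.card_univ, Fintype.card_fin, nsmul_eq_mul]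
      refine (mul_le_mul_of_nonneg_right (h4 n hn) (sq_nonneg _)).trans_eq ?_
      field_simp

end Concentration

/-! ### Quantitative central limit theorem for the expected characteristic function -/

section MeanCharFun

/-- Factors are replaced one at a time; all the others have norm at most 1. -/
lemma norm_prod_sub_prod_le_sum {ι : Type*} (s : Finset ι) {a b : ι → ℂ} (ha : ∀ i ∈ s, ‖a i‖ ≤ 1)
    (hb : ∀ i ∈ s, ‖b i‖ ≤ 1) : ‖∏ i ∈ s, a i - ∏ i ∈ s, b i‖ ≤ ∑ i ∈ s, ‖a i - b i‖ := by
  classical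
  induction s using Finset.induction_on with
  | empty => simp
  | insert i s his ih =>
    have ih' := ih (fun j hj => ha j (Finset.mem_insert_of_mem hj))
      (fun j hj => hb j (Finset.mem_insert_of_mem hj))
    rw [Finset.prod_insert his, Finset.prod_insert his, Finset.sum_insert his]
    have e : a i * ∏ j ∈ s, a j - b i * ∏ j ∈ s, b j =
        (a i - b i) * ∏ j ∈ s, a j + b i * (∏ j ∈ s, a j - ∏ j ∈ s, b j) := by ring
    have h1 : ‖∏ j ∈ s, a j‖ ≤ 1 := by
      rw [norm_prod]
      exact Finset.prod_le_one (fun _ _ => norm_nonneg _)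
        fun j hj => ha j (Finset.mem_insert_of_mem hj)
    rw [e]
    refine (norm_add_le _ _).trans (add_le_add ?_ ?_)
    · rw [norm_mul]; exact mul_le_of_le_one_right (norm_nonneg _) h1
    · rw [norm_mul]
      exact (mul_le_of_le_one_left (norm_nonneg _) (hb i (Finset.mem_insert_self i s))).trans ih'

lemma norm_exp_mul_I_sub_quadratic_le {w : ℝ} (hw : |w| ≤ 1) :
    ‖Complex.exp (w * Complex.I) - (1 + w * Complex.I - (w ^ 2 / 2 : ℝ))‖ ≤ |w| ^ 3 := by
  have h1 : ‖(w : ℂ) * Complex.I‖ = |w| := by simp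
  have h := Complex.exp_bound (x := w * Complex.I) (h1.le.trans hw) (n := 3) (by norm_num)
  rw [h1] at h
  have e : ∑ m ∈ Finset.range 3, ((w : ℂ) * Complex.I) ^ m / (m.factorial : ℂ) =
      1 + w * Complex.I - (w ^ 2 / 2 : ℝ) := by
    simp [Finset.sum_range_succ, Nat.factorial, mul_pow]; ring
  rw [e] at h
  refine h.trans (mul_le_of_le_one_right (by positivity) ?_)
  norm_num [Nat.factorial]

lemma abs_exp_neg_sub_exp_neg_le {a b : ℝ} (ha : 0 ≤ a) (hb : 0 ≤ b) :
    |Real.exp (-a) - Real.exp (-b)| ≤ |a - b| := by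
  have key : ∀ {a b : ℝ}, 0 ≤ a → Real.exp (-a) - Real.exp (-b) ≤ |a - b| := by
    intro a b ha
    have h1 : Real.exp (-b) = Real.exp (-a) * Real.exp (a - b) := by rw [← Real.exp_add]; ring_nf
    have h2 := Real.add_one_le_exp (a - b)
    have h3 : Real.exp (-a) ≤ 1 := Real.exp_le_one_iff.2 (by linarith)
    have h4 := Real.exp_pos (-a)
    rw [h1]
    have h5 := neg_abs_le (a - b)
    nlinarith [abs_nonneg (a - b)]
  rw [abs_le]
  have h1 := key (b := b) ha
  have h2 := key (b := a) hb
  rw [abs_sub_comm] at h2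
  constructor <;> linarith

variable {Ω : Type*} [MeasurableSpace Ω] {P : Measure Ω}

lemma integral_exp_circEig {Z : ℕ → Ω → ℝ} (hZ : ∀ j, Measurable (Z j)) (hindep : iIndepFun Z P)
    (n k : ℕ) (s : ℝ) :
    ∫ ω, Complex.exp ((s * circEig (fun j => Z j ω) n k : ℝ) * Complex.I) ∂P =
      ∏ j ∈ Finset.range (n / 2 + 1),
        ∫ ω, Complex.exp ((s * circCoeff n j k * Z j ω : ℝ) * Complex.I) ∂P := by
  have h1 : ∀ ω, Complex.exp ((s * circEig (fun j => Z j ω) n k : ℝ) * Complex.I) =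
      ∏ j : Fin (n / 2 + 1), Complex.exp ((s * circCoeff n j k * Z j ω : ℝ) * Complex.I) := by
    intro ω
    rw [← Complex.exp_sum, circEig, Finset.sum_range, Finset.mul_sum, Complex.ofReal_sum,
      Finset.sum_mul]
    simp only [mul_assoc]
  simp_rw [h1]
  have hi : iIndepFun (fun (j : Fin (n / 2 + 1)) ω =>
      Complex.exp ((s * circCoeff n j k * Z j ω : ℝ) * Complex.I)) P :=
    (hindep.precomp (g := fun j : Fin (n / 2 + 1) => (j : ℕ)) Fin.val_injective).comp
      (fun j y => Complex.exp ((s * circCoeff n j k * y : ℝ) * Complex.I)) fun j => by fun_prop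
  rw [hi.integral_fun_prod_eq_prod_integral fun j => by fun_prop, Finset.prod_range]

variable [IsProbabilityMeasure P]

lemma integrable_exp_circEig {Z : ℕ → Ω → ℝ} (hZ : ∀ j, Measurable (Z j)) (n k : ℕ) (s : ℝ) :
    Integrable (fun ω => Complex.exp ((s * circEig (fun j => Z j ω) n k : ℝ) * Complex.I)) P := by
  refine Integrable.of_bound ?_ 1 (ae_of_all _ fun ω => by rw [Complex.norm_exp_ofReal_mul_I])
  unfold circEig
  fun_prop

/-- The characteristic function of a bounded centred variable is close to a Gaussian one. -/
lemma norm_integral_exp_sub_gaussian_le {Z : Ω → ℝ} (hZ : Measurable Z) {B : ℝ}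
    (hB : ∀ ω, |Z ω| ≤ B) (h0 : ∫ ω, Z ω ∂P = 0) {v u : ℝ} (hv : 0 ≤ v) (hu : |u| * B ≤ 1)
    (huv : u ^ 2 * v ≤ 2) :
    ‖∫ ω, Complex.exp ((u * Z ω : ℝ) * Complex.I) ∂P - (Real.exp (-(u ^ 2 * v / 2)) : ℝ)‖ ≤
      |u| ^ 3 * B ^ 3 + u ^ 4 * v ^ 2 + u ^ 2 * |∫ ω, Z ω ^ 2 ∂P - v| := by
  have hZi : Integrable Z P := integrable_of_measurable_of_abs_le hZ hB
  have hZ2 : Integrable (fun ω => Z ω ^ 2) P :=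
    integrable_of_measurable_of_abs_le (hZ.pow_const 2) (K := B ^ 2) fun ω => by
      rw [abs_pow]; exact pow_le_pow_left₀ (abs_nonneg _) (hB ω) 2
  have hE : Integrable (fun ω => Complex.exp ((u * Z ω : ℝ) * Complex.I)) P :=
    Integrable.of_bound (by fun_prop) 1 (ae_of_all _ fun ω => by rw [Complex.norm_exp_ofReal_mul_I])
  have hw : ∀ ω, |u * Z ω| ≤ |u| * B := fun ω => by
    rw [abs_mul]; exact mul_le_mul_of_nonneg_left (hB ω) (abs_nonneg u)
  have e1 : Integrable (fun ω => ((u * Z ω : ℝ) : ℂ) * Complex.I) P :=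
    ((hZi.const_mul u).ofReal).mul_const _
  have e2 : Integrable (fun ω => (1 : ℂ) + ((u * Z ω : ℝ) : ℂ) * Complex.I) P :=
    (integrable_const _).add e1
  have e3 : Integrable (fun ω => (((u * Z ω) ^ 2 / 2 : ℝ) : ℂ)) P := by
    refine Integrable.ofReal ?_
    simp_rw [mul_pow]
    exact (hZ2.const_mul _).div_const _
  have e4 : Integrable (fun ω => (1 : ℂ) + ((u * Z ω : ℝ) : ℂ) * Complex.I -
      (((u * Z ω) ^ 2 / 2 : ℝ) : ℂ)) P := e2.sub e3
  have hint : ∫ ω, ((1 : ℂ) + ((u * Z ω : ℝ) : ℂ) * Complex.I - (((u * Z ω) ^ 2 / 2 : ℝ) : ℂ)) ∂P =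
      ((1 - u ^ 2 * (∫ ω, Z ω ^ 2 ∂P) / 2 : ℝ) : ℂ) := by
    rw [integral_sub e2 e3, integral_add (integrable_const _) e1, integral_mul_const,
      integral_complex_ofReal, integral_complex_ofReal, integral_const_mul, h0]
    simp_rw [mul_pow]
    rw [integral_div, integral_const_mul]
    simp
  have hA : ‖∫ ω, Complex.exp ((u * Z ω : ℝ) * Complex.I) ∂P -
      ((1 - u ^ 2 * (∫ ω, Z ω ^ 2 ∂P) / 2 : ℝ) : ℂ)‖ ≤ |u| ^ 3 * B ^ 3 := by
    rw [← hint, ← integral_sub hE e4]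
    refine (norm_integral_le_of_norm_le_const (C := |u| ^ 3 * B ^ 3) (ae_of_all _ fun ω => ?_)).trans
      (by simp)
    refine (norm_exp_mul_I_sub_quadratic_le ((hw ω).trans hu)).trans ?_
    rw [← mul_pow]
    exact pow_le_pow_left₀ (abs_nonneg _) (hw ω) 3
  -- The condition u²v ≤ 2 puts the exponent in [-1, 0], where |eˣ - 1 - x| ≤ x². Replacing the true
  -- second moment by v costs the last term.
  have hG : |(1 - u ^ 2 * (∫ ω, Z ω ^ 2 ∂P) / 2) - Real.exp (-(u ^ 2 * v / 2))| ≤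
      u ^ 4 * v ^ 2 + u ^ 2 * |∫ ω, Z ω ^ 2 ∂P - v| := by
    have h1 : |-(u ^ 2 * v / 2)| ≤ 1 := by
      rw [abs_neg, abs_of_nonneg (by positivity)]; linarith
    have h2 := abs_le.1 (Real.abs_exp_sub_one_sub_id_le h1)
    have h3 := abs_le.1 (le_refl |∫ ω, Z ω ^ 2 ∂P - v|)
    have h4 : (0:ℝ) ≤ u ^ 2 := sq_nonneg u
    have h5 : 0 ≤ u ^ 4 * v ^ 2 := by positivity
    rw [abs_le]
    constructor <;> nlinarith [mul_le_mul_of_nonneg_left h3.1 h4, mul_le_mul_of_nonneg_left h3.2 h4]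
  have hG' : ‖((1 - u ^ 2 * (∫ ω, Z ω ^ 2 ∂P) / 2 : ℝ) : ℂ) -
      (Real.exp (-(u ^ 2 * v / 2)) : ℝ)‖ ≤ u ^ 4 * v ^ 2 + u ^ 2 * |∫ ω, Z ω ^ 2 ∂P - v| := by
    rw [← Complex.ofReal_sub, Complex.norm_real]; exact hG
  refine (norm_sub_le_norm_sub_add_norm_sub _ _ _).trans ((add_le_add hA hG').trans_eq ?_)
  ring

/-- The expected exponential of a bulk eigenvalue. -/
lemma norm_integral_exp_circEig_sub_le {Z : ℕ → Ω → ℝ} (hZ : ∀ j, Measurable (Z j))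
    (hindep : iIndepFun Z P) {B v ε : ℝ} (hB : ∀ j ω, |Z j ω| ≤ B) (h0 : ∀ j, ∫ ω, Z j ω ∂P = 0)
    (hv : 0 ≤ v) (hε : ∀ j, |∫ ω, Z j ω ^ 2 ∂P - v| ≤ ε) {s : ℝ} (hsB : 2 * |s| * B ≤ 1)
    (hsv : 2 * (s ^ 2 * v) ≤ 1) {n k : ℕ} (hn : 0 < n) :
    ‖∫ ω, Complex.exp ((s * circEig (fun j => Z j ω) n k : ℝ) * Complex.I) ∂P -
      (Real.exp (-(s ^ 2 * v / 2 * ∑ j ∈ Finset.range (n / 2 + 1), circCoeff n j k ^ 2)) : ℝ)‖ ≤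
      n * (8 * |s| ^ 3 * B ^ 3 + 16 * s ^ 4 * v ^ 2 + 4 * s ^ 2 * ε) := by
  have hB0 : 0 ≤ B := by
    have : Nonempty Ω := P.nonempty_of_neZero
    exact (abs_nonneg _).trans (hB 0 (Classical.arbitrary Ω))
  have hε0 : 0 ≤ ε := (abs_nonneg _).trans (hε 0)
  have hprod : ((Real.exp (-(s ^ 2 * v / 2 * ∑ j ∈ Finset.range (n / 2 + 1), circCoeff n j k ^ 2)) : ℝ) : ℂ) =
      ∏ j ∈ Finset.range (n / 2 + 1), ((Real.exp (-((s * circCoeff n j k) ^ 2 * v / 2)) : ℝ) : ℂ) := by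
    rw [← Complex.ofReal_prod, ← Real.exp_sum, Finset.mul_sum, ← Finset.sum_neg_distrib]
    congr 2
    exact Finset.sum_congr rfl fun j _ => by ring
  rw [integral_exp_circEig hZ hindep, hprod]
  refine (norm_prod_sub_prod_le_sum _ (fun j _ => ?_) (fun j _ => ?_)).trans ?_
  · refine (norm_integral_le_of_norm_le_const (C := 1) (ae_of_all _ fun ω => ?_)).trans (by simp)
    rw [Complex.norm_exp_ofReal_mul_I]
  · rw [Complex.norm_real, Real.norm_eq_abs, Real.abs_exp, Real.exp_le_one_iff]
    have : 0 ≤ (s * circCoeff n j k) ^ 2 * v / 2 := by positivity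
    linarith
  · have hterm : ∀ j ∈ Finset.range (n / 2 + 1),
        ‖∫ ω, Complex.exp ((s * circCoeff n j k * Z j ω : ℝ) * Complex.I) ∂P -
          ((Real.exp (-((s * circCoeff n j k) ^ 2 * v / 2)) : ℝ) : ℂ)‖ ≤
        8 * |s| ^ 3 * B ^ 3 + 16 * s ^ 4 * v ^ 2 + 4 * s ^ 2 * ε := by
      intro j _
      have hc := abs_circCoeff_le n j k
      have hu : |s * circCoeff n j k| ≤ 2 * |s| := by
        rw [abs_mul, mul_comm]; exact mul_le_mul_of_nonneg_right hc (abs_nonneg s)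
      have hu2 : (s * circCoeff n j k) ^ 2 ≤ 4 * s ^ 2 := by
        rw [← sq_abs, ← sq_abs s]
        refine (pow_le_pow_left₀ (abs_nonneg _) hu 2).trans_eq (by ring)
      have hu3 : |s * circCoeff n j k| ^ 3 ≤ 8 * |s| ^ 3 :=
        (pow_le_pow_left₀ (abs_nonneg _) hu 3).trans_eq (by ring)
      have hu4 : (s * circCoeff n j k) ^ 4 ≤ 16 * s ^ 4 := by
        have := pow_le_pow_left₀ (sq_nonneg _) hu2 2
        nlinarith
      refine (norm_integral_exp_sub_gaussian_le (hZ j) (hB j) (h0 j) hv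
        ((mul_le_mul_of_nonneg_right hu hB0).trans hsB) ?_).trans ?_
      · nlinarith [mul_le_mul_of_nonneg_right hu2 hv]
      · gcongr
        exact hε j
    refine (Finset.sum_le_card_nsmul _ _ _ hterm).trans ?_
    rw [Finset.card_range, nsmul_eq_mul]
    refine mul_le_mul_of_nonneg_right ?_ (by positivity)
    exact_mod_cast (show n / 2 + 1 ≤ n by omega)

/-- The expected characteristic function of the spectral measure of a circulant matrix. -/
lemma norm_integral_circCharFun_sub_le {Z : ℕ → Ω → ℝ} (hZ : ∀ j, Measurable (Z j))
    (hindep : iIndepFun Z P) {B v ε : ℝ} (hB : ∀ j ω, |Z j ω| ≤ B) (h0 : ∀ j, ∫ ω, Z j ω ∂P = 0)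
    (hv : 0 ≤ v) (hε : ∀ j, |∫ ω, Z j ω ^ 2 ∂P - v| ≤ ε) {s t : ℝ} (hsB : 2 * |s| * B ≤ 1)
    (hsv : 2 * (s ^ 2 * v) ≤ 1) {n : ℕ} (hn : 0 < n) (hst : n * (s ^ 2 * v) = t ^ 2) :
    ‖∫ ω, circCharFun (fun j => Z j ω) n s ∂P - (Real.exp (-(t ^ 2 / 2)) : ℝ)‖ ≤
      n * (8 * |s| ^ 3 * B ^ 3 + 16 * s ^ 4 * v ^ 2 + 4 * s ^ 2 * ε) + (t ^ 2 + 4) / n := by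
  have hN : (0 : ℝ) < n := by exact_mod_cast hn
  have hε0 : 0 ≤ ε := (abs_nonneg _).trans (hε 0)
  have hB0 : 0 ≤ B := by
    have : Nonempty Ω := P.nonempty_of_neZero
    exact (abs_nonneg _).trans (hB 0 (Classical.arbitrary Ω))
  set R := n * (8 * |s| ^ 3 * B ^ 3 + 16 * s ^ 4 * v ^ 2 + 4 * s ^ 2 * ε) with hR
  have hR0 : 0 ≤ R := by positivity
  have hbulk : ∀ k, ¬ n ∣ 2 * k →
      ‖∫ ω, Complex.exp ((s * circEig (fun j => Z j ω) n k : ℝ) * Complex.I) ∂P -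
        (Real.exp (-(t ^ 2 / 2)) : ℝ)‖ ≤ R + t ^ 2 / n := by
    intro k hk
    refine (norm_sub_le_norm_sub_add_norm_sub _ _ _).trans (add_le_add
      (norm_integral_exp_circEig_sub_le hZ hindep hB h0 hv hε hsB hsv hn) ?_)
    rw [← Complex.ofReal_sub, Complex.norm_real]
    refine (abs_exp_neg_sub_exp_neg_le (by positivity) (by positivity)).trans ?_
    have h1 : s ^ 2 * v = t ^ 2 / n := by rw [← hst]; field_simp
    have h2 := abs_sum_sq_circCoeff_sub_le hn hk
    rw [h1, show t ^ 2 / n / 2 * ∑ j ∈ Finset.range (n / 2 + 1), circCoeff n j k ^ 2 - t ^ 2 / 2 =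
      t ^ 2 / n / 2 * (∑ j ∈ Finset.range (n / 2 + 1), circCoeff n j k ^ 2 - n) by field_simp,
      abs_mul, abs_of_nonneg (by positivity)]
    calc _ ≤ t ^ 2 / n / 2 * 2 := mul_le_mul_of_nonneg_left h2 (by positivity)
      _ = _ := by ring
  -- The indices k = 0 and 2k = n have the wrong variance and are estimated trivially by 2. After
  -- averaging they contribute at most 4/n.
  have hall : ∀ k ∈ Finset.range n,
      ‖∫ ω, Complex.exp ((s * circEig (fun j => Z j ω) n k : ℝ) * Complex.I) ∂P -
        (Real.exp (-(t ^ 2 / 2)) : ℝ)‖ ≤ (R + t ^ 2 / n) + if n ∣ 2 * k then 2 else 0 := by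
    intro k _
    split_ifs with hk
    · refine le_add_of_nonneg_of_le (by positivity) ((norm_sub_le _ _).trans ?_)
      have h1 : ‖∫ ω, Complex.exp ((s * circEig (fun j => Z j ω) n k : ℝ) * Complex.I) ∂P‖ ≤ 1 :=
        (norm_integral_le_of_norm_le_const (C := 1) (ae_of_all _ fun ω => by
          rw [Complex.norm_exp_ofReal_mul_I])).trans (by simp)
      have h2 : ‖((Real.exp (-(t ^ 2 / 2)) : ℝ) : ℂ)‖ ≤ 1 := by
        rw [Complex.norm_real, Real.norm_eq_abs, Real.abs_exp, Real.exp_le_one_iff]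
        have := sq_nonneg t
        linarith
      linarith
    · rw [add_zero]; exact hbulk k hk
  have hcard : ((Finset.range n).filter (fun k => n ∣ 2 * k)).card ≤ 2 := by
    refine le_trans (Finset.card_le_card (t := {0, n / 2}) fun k hk => ?_) Finset.card_le_two
    simp only [Finset.mem_filter, Finset.mem_range, Finset.mem_insert, Finset.mem_singleton] at *
    obtain ⟨hk, c, hc⟩ := hk
    have : c < 2 := by
      by_contra h
      have := Nat.mul_le_mul_left n (not_lt.1 h)
      omega
    interval_cases c <;> omega
  have hint : ∫ ω, circCharFun (fun j => Z j ω) n s ∂P - (Real.exp (-(t ^ 2 / 2)) : ℝ) =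
      (n : ℂ)⁻¹ * ∑ k ∈ Finset.range n,
        (∫ ω, Complex.exp ((s * circEig (fun j => Z j ω) n k : ℝ) * Complex.I) ∂P -
          (Real.exp (-(t ^ 2 / 2)) : ℝ)) := by
    have hn0 : (n : ℂ) ≠ 0 := by exact_mod_cast hn.ne'
    simp only [circCharFun]
    rw [integral_const_mul, integral_finsetSum _ fun k _ => integrable_exp_circEig hZ n k s, Finset.sum_sub_distrib, mul_sub,
      Finset.sum_const, Finset.card_range, nsmul_eq_mul, inv_mul_cancel_left₀ hn0]
  rw [hint, norm_mul, norm_inv, Complex.norm_natCast, inv_mul_le_iff₀ hN]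
  refine (norm_sum_le _ _).trans ((Finset.sum_le_sum hall).trans ?_)
  rw [Finset.sum_add_distrib, Finset.sum_const, Finset.card_range, ← Finset.sum_filter, Finset.sum_const,
    nsmul_eq_mul, nsmul_eq_mul]
  have hcard' : (((Finset.range n).filter (fun k => n ∣ 2 * k)).card : ℝ) ≤ 2 := by exact_mod_cast hcard
  calc (n : ℝ) * (R + t ^ 2 / n) + ((Finset.range n).filter (fun k => n ∣ 2 * k)).card * 2 ≤
      (n : ℝ) * (R + t ^ 2 / n) + 2 * 2 := by gcongr
    _ = _ := by field_simp; ring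

end MeanCharFun

/-! ### Removing the truncation -/

section Centred

variable {Ω : Type*} [MeasurableSpace Ω] {P : Measure Ω} {X : ℕ → Ω → ℝ}

/-- The truncated and recentred variables. -/
noncomputable def centredClip (P : Measure Ω) (X : ℕ → Ω → ℝ) (n j : ℕ) (y : ℝ) : ℝ :=
  clip (truncLevel n) y - ∫ ω, clip (truncLevel n) (X j ω) ∂P

lemma measurable_centredClip (n j : ℕ) : Measurable (centredClip P X n j) :=
  (measurable_clip _).sub_const _

lemma abs_centredClip_sub_le (n j : ℕ) (y z : ℝ) :
    |centredClip P X n j y - centredClip P X n j z| ≤ 2 * truncLevel n := by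
  have h := fun y => abs_clip_le (truncLevel_nonneg n) y
  rw [two_mul, centredClip, centredClip, sub_sub_sub_cancel_right]
  exact (abs_sub _ _).trans (add_le_add (h y) (h z))

variable [IsProbabilityMeasure P]

/-- The part of the variables beyond the truncation level is negligible in mean square. -/
lemma ae_tendsto_sum_sq_sub_clip (hmeas : ∀ j, Measurable (X j))
    (hmom : ∀ j, Integrable (fun ω => |X j ω| ^ 3) P) {M : ℝ} (hM : ∀ j, ∫ ω, |X j ω| ^ 3 ∂P ≤ M) :
    ∀ᵐ ω ∂P, Tendsto (fun n : ℕ => (n : ℝ)⁻¹ * ∑ j ∈ Finset.range (n / 2 + 1),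
      (X j ω - clip (truncLevel n) (X j ω)) ^ 2) atTop (𝓝 0) := by
  have hC : ∀ k : ℕ, 0 < truncLevel (2 ^ k) := fun k =>
    zero_lt_one.trans_le (one_le_truncLevel (by positivity))
  have h2 : (1 : ℝ) < truncLevel 2 := Real.one_lt_rpow (by norm_num) (by norm_num)
  -- The expected tail average is only O(n^(-1/16)), not summable over n. Along n = 2^k it decays
  -- geometrically.
  have hV := ae_tendsto_zero_of_summable_integral (P := P)
    (V := fun k ω => ((2 ^ k : ℕ) : ℝ)⁻¹ * ∑ j ∈ Finset.range (2 ^ k),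
      (X j ω - clip (truncLevel (2 ^ k)) (X j ω)) ^ 2)
    (fun k => (integrable_finsetSum _ fun j _ =>
      integrable_sq_sub_clip (hC k) (hmeas j) (hmom j)).const_mul _)
    (fun k ω => by positivity) (b := fun k => M * (truncLevel 2)⁻¹ ^ k) (fun k => ?_)
    ((summable_geometric_of_lt_one (by positivity) (inv_lt_one_of_one_lt₀ h2)).mul_left M)
  · filter_upwards [hV] with ω hω
    have hlog : Tendsto (Nat.log 2) atTop atTop :=
      tendsto_atTop.2 fun k => (eventually_ge_atTop (2 ^ k)).mono fun n hn =>
        Nat.le_log_of_pow_le (by norm_num) hn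
    refine squeeze_zero' (Eventually.of_forall fun n => by positivity) ?_ (hω.comp hlog)
    filter_upwards [eventually_gt_atTop 0] with n hn
    have h1 : 2 ^ Nat.log 2 n ≤ n := Nat.pow_log_le_self 2 hn.ne'
    have h3 : n < 2 ^ (Nat.log 2 n + 1) := Nat.lt_pow_succ_log_self (by norm_num) n
    rw [pow_succ] at h3
    simp only [Function.comp_def]
    -- With 2^l ≤ n < 2^(l+1), the sum has n/2 + 1 ≤ 2^l terms, so passing from n to 2^l enlarges
    -- the average without any loss of constant.
    refine mul_le_mul (inv_anti₀ (by positivity) (by exact_mod_cast h1)) ?_ (by positivity)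
      (by positivity)
    refine (Finset.sum_le_sum fun j _ => sq_sub_clip_le_of_le (truncLevel_mono h1) _).trans ?_
    exact Finset.sum_le_sum_of_subset_of_nonneg (Finset.range_mono (by omega)) fun _ _ _ => sq_nonneg _
  · rw [integral_const_mul, integral_finsetSum _ fun j _ =>
      integrable_sq_sub_clip (hC k) (hmeas j) (hmom j)]
    have h3 := Finset.sum_le_card_nsmul (Finset.range (2 ^ k)) _ _ fun j _ =>
      integral_sq_sub_clip_le (hC k) (hmeas j) (hmom j) (hM j)
    rw [Finset.card_range, nsmul_eq_mul] at h3
    have hp : (0 : ℝ) < ((2 ^ k : ℕ) : ℝ) := by positivity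
    rw [inv_mul_le_iff₀ hp]
    refine h3.trans_eq ?_
    rw [truncLevel_two_pow, inv_pow, div_eq_mul_inv]

/-- The empirical second moments are almost surely bounded. -/
lemma ae_eventually_sum_sq_le (hmeas : ∀ j, Measurable (X j)) (hindep : iIndepFun X P)
    (hmom : ∀ j, Integrable (fun ω => |X j ω| ^ 3) P) {M : ℝ} (hM : ∀ j, ∫ ω, |X j ω| ^ 3 ∂P ≤ M)
    {v : ℝ} (h2 : ∀ j, ∫ ω, X j ω ^ 2 ∂P = v) :
    ∀ᵐ ω ∂P, ∀ᶠ n : ℕ in atTop,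
      (n : ℝ)⁻¹ * ∑ j ∈ Finset.range (n / 2 + 1), X j ω ^ 2 ≤ v + 2 := by
  filter_upwards [ae_tendsto_sum_sq_sub_clip hmeas hmom hM, ae_tendsto_sum_sq_clip_sub hmeas hindep]
    with ω h1 h3
  filter_upwards [h1.eventually_le_const zero_lt_one, h3.eventually_le_const zero_lt_one,
    eventually_gt_atTop 0] with n hn1 hn3 hn
  have hN : (0 : ℝ) < n := by exact_mod_cast hn
  have hv0 : 0 ≤ v := by rw [← h2 0]; exact integral_nonneg fun _ => sq_nonneg _
  have hi : ∀ j, Integrable (fun ω => clip (truncLevel n) (X j ω) ^ 2) P := fun j =>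
    integrable_sq_clip (truncLevel_nonneg n) (hmeas j)
  have hE : ∫ ω, (n : ℝ)⁻¹ * ∑ j ∈ Finset.range (n / 2 + 1), clip (truncLevel n) (X j ω) ^ 2 ∂P ≤ v := by
    rw [integral_const_mul, integral_finsetSum _ fun j _ => hi j, inv_mul_le_iff₀ hN]
    have h4 : ∀ j ∈ Finset.range (n / 2 + 1), ∫ ω, clip (truncLevel n) (X j ω) ^ 2 ∂P ≤ v := by
      intro j _
      rw [← h2 j]
      refine integral_mono (hi j) (integrable_sq_of_integrable_abs_pow_three (hmeas j) (hmom j))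
        fun ω => ?_
      have := sq_sub_sq_clip (truncLevel n) (X j ω)
      simp only
      nlinarith [sq_nonneg (X j ω - clip (truncLevel n) (X j ω))]
    refine (Finset.sum_le_card_nsmul _ _ _ h4).trans ?_
    rw [Finset.card_range, nsmul_eq_mul]
    refine mul_le_mul_of_nonneg_right ?_ hv0
    exact_mod_cast (show n / 2 + 1 ≤ n by omega)
  have e : ∑ j ∈ Finset.range (n / 2 + 1), X j ω ^ 2 =
      ∑ j ∈ Finset.range (n / 2 + 1), clip (truncLevel n) (X j ω) ^ 2 +
      ∑ j ∈ Finset.range (n / 2 + 1), (X j ω - clip (truncLevel n) (X j ω)) ^ 2 := by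
    rw [← Finset.sum_add_distrib]
    exact Finset.sum_congr rfl fun j _ => by rw [← sq_sub_sq_clip]; ring
  rw [e, mul_add]
  linarith

lemma abs_centredClip_le (n j : ℕ) (y : ℝ) : |centredClip P X n j y| ≤ 2 * truncLevel n := by
  have h := fun y => abs_clip_le (truncLevel_nonneg n) y
  rw [two_mul]
  exact (abs_sub _ _).trans (add_le_add (h y) (abs_integral_le_of_abs_le fun _ => h _))

/-- Recentring the truncated variables does not change the conclusion on the remainder. -/
lemma ae_tendsto_sum_sq_sub_centredClip (hmeas : ∀ j, Measurable (X j))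
    (hmom : ∀ j, Integrable (fun ω => |X j ω| ^ 3) P) {M : ℝ} (hM : ∀ j, ∫ ω, |X j ω| ^ 3 ∂P ≤ M)
    (h0 : ∀ j, ∫ ω, X j ω ∂P = 0) :
    ∀ᵐ ω ∂P, Tendsto (fun n : ℕ => (n : ℝ)⁻¹ * ∑ j ∈ Finset.range (n / 2 + 1),
      (X j ω - centredClip P X n j (X j ω)) ^ 2) atTop (𝓝 0) := by
  filter_upwards [ae_tendsto_sum_sq_sub_clip hmeas hmom hM] with ω hω
  have hlim : Tendsto (fun n : ℕ => 2 * ((n : ℝ)⁻¹ * ∑ j ∈ Finset.range (n / 2 + 1),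
      (X j ω - clip (truncLevel n) (X j ω)) ^ 2) + 2 * (M / truncLevel n ^ 2) ^ 2) atTop (𝓝 0) := by
    have h1 : Tendsto (fun n => M / truncLevel n ^ 2) atTop (𝓝 0) :=
      tendsto_const_nhds.div_atTop ((tendsto_pow_atTop two_ne_zero).comp tendsto_truncLevel)
    simpa using (hω.const_mul 2).add ((h1.pow 2).const_mul 2)
  refine squeeze_zero' (Eventually.of_forall fun n => by positivity) ?_ hlim
  filter_upwards [eventually_gt_atTop 0] with n hn
  have hN : (0 : ℝ) < n := by exact_mod_cast hn
  have hC : 0 < truncLevel n := zero_lt_one.trans_le (one_le_truncLevel hn)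
  have h1 : ∀ j ∈ Finset.range (n / 2 + 1), (X j ω - centredClip P X n j (X j ω)) ^ 2 ≤
      2 * (X j ω - clip (truncLevel n) (X j ω)) ^ 2 + 2 * (M / truncLevel n ^ 2) ^ 2 := by
    intro j _
    have h2 := sq_le_sq.2 ((abs_integral_clip_le hC (hmeas j) (hmom j) (hM j) (h0 j)).trans
      (le_abs_self _))
    rw [centredClip]
    set a := ∫ ω, clip (truncLevel n) (X j ω) ∂P
    nlinarith [sq_nonneg (X j ω - clip (truncLevel n) (X j ω) - a)]
  rw [inv_mul_le_iff₀ hN]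
  refine (Finset.sum_le_sum h1).trans ?_
  rw [Finset.sum_add_distrib, ← Finset.mul_sum, Finset.sum_const, Finset.card_range, nsmul_eq_mul,
    mul_add]
  have h4 : ((n / 2 + 1 : ℕ) : ℝ) ≤ n := by exact_mod_cast (show n / 2 + 1 ≤ n by omega)
  refine add_le_add (le_of_eq (by field_simp)) (mul_le_mul_of_nonneg_right h4 (by positivity))

/-- The expected characteristic functions of the truncated matrices converge. -/
lemma tendsto_integral_circCharFun_centredClip (hmeas : ∀ j, Measurable (X j)) (hindep : iIndepFun X P)
    (hmom : ∀ j, Integrable (fun ω => |X j ω| ^ 3) P) {M : ℝ} (hM : ∀ j, ∫ ω, |X j ω| ^ 3 ∂P ≤ M)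
    (h0 : ∀ j, ∫ ω, X j ω ∂P = 0) {σ : ℝ} (hσ : 0 < σ) (h2 : ∀ j, ∫ ω, X j ω ^ 2 ∂P = σ ^ 2) (t : ℝ) :
    Tendsto (fun n : ℕ => ∫ ω, circCharFun (fun j => centredClip P X n j (X j ω)) n (t / σ / √(n : ℝ)) ∂P)
      atTop (𝓝 (Real.exp (-(t ^ 2 / 2)) : ℝ)) := by
  set τ := t / σ with hτ
  have hC := tendsto_truncLevel
  have hCp : ∀ p : ℕ, p ≠ 0 → Tendsto (fun n => truncLevel n ^ p) atTop atTop := fun p hp =>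
    (tendsto_pow_atTop hp).comp hC
  have hinv : ∀ (c : ℝ) (p : ℕ), p ≠ 0 → Tendsto (fun n => c / truncLevel n ^ p) atTop (𝓝 0) :=
    fun c p hp => tendsto_const_nhds.div_atTop (hCp p hp)
  -- These are the error terms of `norm_integral_circCharFun_sub_le` for s = τ/√n = τ/C⁸ and B = 2C,
  -- with n written as C¹⁶.
  have hlim : Tendsto (fun n => 64 * |τ| ^ 3 / truncLevel n ^ 5 + 16 * τ ^ 4 * (σ ^ 2) ^ 2 / truncLevel n ^ 16 +
      4 * τ ^ 2 * (M / truncLevel n ^ 1 + (M / truncLevel n ^ 2) ^ 2) +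
      (t ^ 2 + 4) / truncLevel n ^ 16) atTop (𝓝 0) := by
    have := (((hinv (64 * |τ| ^ 3) 5 (by norm_num)).add
      (hinv (16 * τ ^ 4 * (σ ^ 2) ^ 2) 16 (by norm_num))).add
      (((hinv M 1 (by norm_num)).add ((hinv M 2 (by norm_num)).pow 2)).const_mul (4 * τ ^ 2))).add
      (hinv (t ^ 2 + 4) 16 (by norm_num))
    simpa using this
  rw [tendsto_iff_norm_sub_tendsto_zero]
  refine squeeze_zero' (Eventually.of_forall fun _ => norm_nonneg _) ?_ hlim
  filter_upwards [eventually_gt_atTop 0,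
    (hinv (4 * |τ|) 7 (by norm_num)).eventually_le_const zero_lt_one,
    (hinv (2 * t ^ 2) 16 (by norm_num)).eventually_le_const zero_lt_one] with n hn hn1 hn2
  have hN : (0 : ℝ) < n := by exact_mod_cast hn
  have hCn : 0 < truncLevel n := zero_lt_one.trans_le (one_le_truncLevel hn)
  have hs2 : (τ / √(n : ℝ)) ^ 2 * σ ^ 2 = t ^ 2 / truncLevel n ^ 16 := by
    rw [truncLevel_pow, div_pow, Real.sq_sqrt hN.le, hτ]
    field_simp
  have habs : |τ / √(n : ℝ)| = |τ| / truncLevel n ^ 8 := by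
    rw [abs_div, abs_of_nonneg (Real.sqrt_nonneg _), truncLevel_pow_eight]
  have hZi : ∀ j, Integrable (fun ω => clip (truncLevel n) (X j ω)) P := fun j =>
    integrable_clip hCn.le (hmeas j)
  have key := norm_integral_circCharFun_sub_le (P := P)
    (Z := fun j ω => centredClip P X n j (X j ω)) (fun j => (measurable_centredClip n j).comp (hmeas j))
    (hindep.comp (fun j => centredClip P X n j) fun j => measurable_centredClip n j)
    (B := 2 * truncLevel n) (v := σ ^ 2) (ε := M / truncLevel n + (M / truncLevel n ^ 2) ^ 2)
    (fun j ω => abs_centredClip_le n j _) (fun j => ?_) (sq_nonneg σ) (fun j => ?_)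
    (s := τ / √(n : ℝ)) (t := t) ?_ ?_ hn ?_
  · refine key.trans_eq ?_
    have hs2' : (τ / √(n : ℝ)) ^ 2 = τ ^ 2 / truncLevel n ^ 16 := by
      rw [truncLevel_pow, div_pow, Real.sq_sqrt hN.le]
    have hs4 : (τ / √(n : ℝ)) ^ 4 = τ ^ 4 / truncLevel n ^ 32 := by
      rw [show (τ / √(n : ℝ)) ^ 4 = ((τ / √(n : ℝ)) ^ 2) ^ 2 by ring, hs2']; field_simp
    rw [habs, hs4, hs2', ← truncLevel_pow n]
    field_simp
    ring
  · simp only [centredClip]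
    rw [integral_sub (hZi j) (integrable_const _)]
    simp
  · exact abs_integral_sq_centred_clip_sub_le hCn (hmeas j) (hmom j) (hM j) (h0 j) (h2 j)
  · rw [habs]
    refine le_of_eq_of_le ?_ hn1
    field_simp
    ring
  · rw [hs2, ← mul_div_assoc]; exact hn2
  · rw [hs2, truncLevel_pow]; field_simp

/-- Almost sure convergence of the characteristic functions at a given point. -/
lemma ae_tendsto_circCharFun (hmeas : ∀ j, Measurable (X j)) (hindep : iIndepFun X P)
    (hmom : ∀ j, Integrable (fun ω => |X j ω| ^ 3) P) {M : ℝ} (hM : ∀ j, ∫ ω, |X j ω| ^ 3 ∂P ≤ M)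
    (h0 : ∀ j, ∫ ω, X j ω ∂P = 0) {σ : ℝ} (hσ : 0 < σ) (h2 : ∀ j, ∫ ω, X j ω ^ 2 ∂P = σ ^ 2) (t : ℝ) :
    ∀ᵐ ω ∂P, Tendsto (fun n : ℕ => circCharFun (fun j => X j ω) n (t / σ / √(n : ℝ)))
      atTop (𝓝 (Real.exp (-(t ^ 2 / 2)) : ℝ)) := by
  have hmean := tendsto_integral_circCharFun_centredClip hmeas hindep hmom hM h0 hσ h2 t
  have hcos := ae_tendsto_circulant_statistic_sub hmeas hindep (g := Real.cos) (h := fun u => -Real.sin u)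
    Real.measurable_cos Real.abs_cos_le_one (fun u => by rw [abs_neg]; exact Real.abs_sin_le_one u)
    abs_cos_taylor_le (centredClip P X) (fun n j => measurable_centredClip n j) (fun n j => abs_centredClip_sub_le n j)
    (t / σ)
  have hsin := ae_tendsto_circulant_statistic_sub hmeas hindep (g := Real.sin) (h := Real.cos)
    Real.measurable_sin Real.abs_sin_le_one Real.abs_cos_le_one
    abs_sin_taylor_le (centredClip P X) (fun n j => measurable_centredClip n j) (fun n j => abs_centredClip_sub_le n j)
    (t / σ)
  have hre : ∀ x n s, (circCharFun x n s).re =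
      (n : ℝ)⁻¹ * ∑ k ∈ Finset.range n, Real.cos (s * circEig x n k) := by
    intro x n s
    rw [circCharFun, ← Complex.ofReal_natCast, ← Complex.ofReal_inv, Complex.re_ofReal_mul, Complex.re_sum]
    simp only [Complex.exp_ofReal_mul_I_re]
  have him : ∀ x n s, (circCharFun x n s).im =
      (n : ℝ)⁻¹ * ∑ k ∈ Finset.range n, Real.sin (s * circEig x n k) := by
    intro x n s
    rw [circCharFun, ← Complex.ofReal_natCast, ← Complex.ofReal_inv, Complex.im_ofReal_mul, Complex.im_sum]
    simp only [Complex.exp_ofReal_mul_I_im]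
  have hint : ∀ n s, Integrable (fun ω => circCharFun (fun j => centredClip P X n j (X j ω)) n s) P := by
    intro n s
    exact (integrable_finsetSum _ fun k _ => integrable_exp_circEig
      (fun j => (measurable_centredClip n j).comp (hmeas j)) n k s).const_mul _
  simp only [← hre, ← him] at hcos hsin
  filter_upwards [hcos, hsin, ae_tendsto_sum_sq_sub_centredClip hmeas hmom hM h0] with ω h1 h3 h4
  have hT : Tendsto (fun n : ℕ => circCharFun (fun j => centredClip P X n j (X j ω)) n (t / σ / √(n : ℝ)) -
      ∫ ω, circCharFun (fun j => centredClip P X n j (X j ω)) n (t / σ / √(n : ℝ)) ∂P) atTop (𝓝 0) := by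
    have e1 : ∀ n s, ∫ ω, (circCharFun (fun j => centredClip P X n j (X j ω)) n s).re ∂P =
        (∫ ω, circCharFun (fun j => centredClip P X n j (X j ω)) n s ∂P).re := fun n s => integral_re (hint n s)
    have e2 : ∀ n s, ∫ ω, (circCharFun (fun j => centredClip P X n j (X j ω)) n s).im ∂P =
        (∫ ω, circCharFun (fun j => centredClip P X n j (X j ω)) n s ∂P).im := fun n s => integral_im (hint n s)
    simp only [e1, e2, ← Complex.sub_re, ← Complex.sub_im] at h1 h3
    rw [tendsto_zero_iff_norm_tendsto_zero]
    refine squeeze_zero (fun _ => norm_nonneg _) (fun n => Complex.norm_le_abs_re_add_abs_im _) ?_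
    simpa using h1.abs.add h3.abs
  -- Undoing truncation and recentring costs the square root of 2(t/σ)² times the mean square
  -- remainder, which tends to 0 along this ω.
  have hdiff : Tendsto (fun n : ℕ => circCharFun (fun j => X j ω) n (t / σ / √(n : ℝ)) -
      circCharFun (fun j => centredClip P X n j (X j ω)) n (t / σ / √(n : ℝ))) atTop (𝓝 0) := by
    rw [tendsto_zero_iff_norm_tendsto_zero]
    have hlim := (Real.continuous_sqrt.tendsto _).comp (h4.const_mul (2 * (t / σ) ^ 2))
    rw [mul_zero, Real.sqrt_zero] at hlim
    refine squeeze_zero' (Eventually.of_forall fun _ => norm_nonneg _) ?_ hlim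
    filter_upwards [eventually_gt_atTop 0] with n hn
    have hN : (0 : ℝ) < n := by exact_mod_cast hn
    refine (norm_circCharFun_sub_le hn _ _ _ _).trans_eq ?_
    simp only [Function.comp_def, ← mul_sub, mul_pow]
    rw [← Finset.mul_sum, div_pow (t / σ), Real.sq_sqrt hN.le]
    congr 1
    field_simp
  have := (hdiff.add hT).add hmean
  simpa using this

end Centred

/-! ### Locally uniform convergence and weak limits -/

section Convergence

/-- Convergence at rational points together with a uniform Lipschitz bound gives locally uniform
convergence of the characteristic functions. -/
lemma tendsto_circCharFun_of_rat {y : ℕ → ℝ} {σ K : ℝ} (hσ : 0 < σ)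
    (hK : ∀ᶠ n : ℕ in atTop, (n : ℝ)⁻¹ * ∑ j ∈ Finset.range (n / 2 + 1), y j ^ 2 ≤ K)
    (hq : ∀ q : ℚ, Tendsto (fun n : ℕ => circCharFun y n (q / σ / √(n : ℝ))) atTop
      (𝓝 (Real.exp (-((q : ℝ) ^ 2 / 2)) : ℝ)))
    {u : ℕ → ℝ} {t : ℝ} (hu : Tendsto u atTop (𝓝 t)) :
    Tendsto (fun n : ℕ => circCharFun y n (u n / σ / √(n : ℝ))) atTop
      (𝓝 (Real.exp (-(t ^ 2 / 2)) : ℝ)) := by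
  -- L is a Lipschitz constant in the argument for all large n at once. It lets the countably many
  -- null sets at rational points suffice for every real t.
  set L := √(2 * K) / σ with hL
  have hL0 : 0 ≤ L := by positivity
  have hlip : ∀ᶠ n : ℕ in atTop, ∀ a b : ℝ,
      ‖circCharFun y n (a / σ / √(n : ℝ)) - circCharFun y n (b / σ / √(n : ℝ))‖ ≤ L * |a - b| := by
    filter_upwards [hK, eventually_gt_atTop 0] with n hn hn0 a b
    have hN : (0 : ℝ) < n := by exact_mod_cast hn0
    refine (norm_circCharFun_sub_le hn0 _ _ _ _).trans ?_
    refine Real.sqrt_le_iff.2 ⟨by positivity, ?_⟩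
    have hK0 : 0 ≤ K := le_trans (by positivity) hn
    simp_rw [← sub_mul, mul_pow]
    rw [← Finset.mul_sum, hL, div_pow, Real.sq_sqrt (by positivity), sq_abs, ← sub_div, ← sub_div, div_pow,
      Real.sq_sqrt hN.le, div_pow]
    calc 2 * ((a - b) ^ 2 / σ ^ 2 / n * ∑ j ∈ Finset.range (n / 2 + 1), y j ^ 2) =
        2 * (a - b) ^ 2 / σ ^ 2 * ((n : ℝ)⁻¹ * ∑ j ∈ Finset.range (n / 2 + 1), y j ^ 2) := by ring
      _ ≤ 2 * (a - b) ^ 2 / σ ^ 2 * K := mul_le_mul_of_nonneg_left hn (by positivity)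
      _ = _ := by ring
  set G : ℝ → ℂ := fun t => (Real.exp (-(t ^ 2 / 2)) : ℝ) with hG
  have hGc : Continuous G := by fun_prop
  rw [Metric.tendsto_nhds]
  intro ε hε
  have hnear : ∀ᶠ s in 𝓝 t, L * |t - s| < ε / 4 ∧ dist (G s) (G t) < ε / 4 := by
    refine Eventually.and ?_ (Metric.tendsto_nhds.1 (hGc.tendsto t) _ (by positivity))
    have : Tendsto (fun s => L * |t - s|) (𝓝 t) (𝓝 (L * |t - t|)) := by
      apply Continuous.tendsto; fun_prop
    rw [sub_self, abs_zero, mul_zero] at this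
    exact this.eventually_lt_const (by positivity)
  obtain ⟨q, hq1, hq2⟩ := (Rat.denseRange_cast (𝕜 := ℝ)).exists_mem_open isOpen_interior
    ⟨t, mem_interior_iff_mem_nhds.2 hnear⟩ |>.imp fun q h => interior_subset h
  have hut : Tendsto (fun n => L * |u n - t|) atTop (𝓝 0) := by
    simpa using ((hu.sub_const t).abs).const_mul L
  filter_upwards [hlip, hut.eventually_lt_const (show 0 < ε / 4 by positivity),
    Metric.tendsto_nhds.1 (hq q) (ε / 4) (by positivity)] with n h1 h2 h3
  have h4 := h1 (u n) q
  have h5 : L * |u n - q| ≤ L * |u n - t| + L * |t - q| := by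
    rw [← mul_add]; exact mul_le_mul_of_nonneg_left (abs_sub_le _ _ _) hL0
  rw [← dist_eq_norm] at h4
  have h6 := dist_triangle4 (circCharFun y n (u n / σ / √(n : ℝ))) (circCharFun y n (q / σ / √(n : ℝ)))
    (G q) (G t)
  calc _ ≤ _ := h6
    _ < ε := by linarith

lemma charFun_gaussianReal_zero_one (t : ℝ) :
    charFun (gaussianReal 0 1) t = (Real.exp (-(t ^ 2 / 2)) : ℝ) := by
  rw [charFun_gaussianReal]; push_cast; congr 1; simp

lemma tendsto_spectralMeasure_symCirculant {x : ℕ → ℝ} {σ : ℝ}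
    (h : ∀ (u : ℕ → ℝ) (t : ℝ), Tendsto u atTop (𝓝 t) →
      Tendsto (fun n : ℕ => circCharFun x n (u n / σ / √(n : ℝ))) atTop
        (𝓝 (Real.exp (-(t ^ 2 / 2)) : ℝ))) :
    Tendsto (fun n : ℕ => spectralMeasure ((σ * √((n + 1 : ℕ) : ℝ))⁻¹ • symCirculant x (n + 1))
        (isHermitian_real_smul (symCirculant_isHermitian _ _) _))
      atTop (𝓝 (⟨gaussianReal 0 1, inferInstance⟩ : ProbabilityMeasure ℝ)) := by
  refine ProbabilityMeasure.tendsto_iff_tendsto_charFun.2 fun t => ?_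
  simp only [ProbabilityMeasure.coe_mk, charFun_gaussianReal_zero_one,
    charFun_spectralMeasure_symCirculant]
  refine ((h (fun _ => t) t tendsto_const_nhds).comp (tendsto_add_atTop_nat 1)).congr fun n => ?_
  simp only [Function.comp_def]
  rw [div_div, div_eq_mul_inv]

lemma tendsto_spectralMeasure_palindromicToeplitz {x : ℕ → ℝ} {σ K : ℝ} (hσ : 0 < σ)
    (hK : ∀ᶠ n : ℕ in atTop, (n : ℝ)⁻¹ * ∑ j ∈ Finset.range (n / 2 + 1), x j ^ 2 ≤ K)
    (h : ∀ (u : ℕ → ℝ) (t : ℝ), Tendsto u atTop (𝓝 t) →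
      Tendsto (fun n : ℕ => circCharFun x n (u n / σ / √(n : ℝ))) atTop
        (𝓝 (Real.exp (-(t ^ 2 / 2)) : ℝ))) :
    Tendsto (fun n : ℕ => spectralMeasure ((σ * √((n + 1 : ℕ) : ℝ))⁻¹ • palindromicToeplitz x (n + 1))
        (isHermitian_real_smul (palindromicToeplitz_isHermitian _ _) _))
      atTop (𝓝 (⟨gaussianReal 0 1, inferInstance⟩ : ProbabilityMeasure ℝ)) := by
  refine ProbabilityMeasure.tendsto_iff_tendsto_charFun.2 fun t => ?_
  simp only [ProbabilityMeasure.coe_mk, charFun_gaussianReal_zero_one]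
  have hinv : Tendsto (fun n : ℕ => ((n + 1 : ℕ) : ℝ)⁻¹) atTop (𝓝 0) :=
    (tendsto_inv_atTop_nhds_zero_nat (𝕜 := ℝ)).comp (tendsto_add_atTop_nat 1)
  have hratio : Tendsto (fun n : ℕ => (n : ℝ) / (n + 1 : ℕ)) atTop (𝓝 1) := by
    have : Tendsto (fun n : ℕ => 1 - ((n + 1 : ℕ) : ℝ)⁻¹) atTop (𝓝 (1 - 0)) := hinv.const_sub 1
    rw [sub_zero] at this
    refine this.congr fun n => ?_
    have : ((n + 1 : ℕ) : ℝ) ≠ 0 := by positivity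
    field_simp
    push_cast; ring
  -- The circulant has size n but is scaled by √(n+1). Moving the ratio into the argument calls for
  -- convergence along a sequence u_n → t.
  have hu : Tendsto (fun n : ℕ => t * √((n : ℝ) / (n + 1 : ℕ))) atTop (𝓝 t) := by
    simpa using ((Real.continuous_sqrt.tendsto 1).comp hratio).const_mul t
  have hmain : Tendsto (fun n : ℕ => ((n + 1 : ℕ) : ℂ)⁻¹ *
      (n * circCharFun x n (t * (σ * √((n + 1 : ℕ) : ℝ))⁻¹) + 1)) atTop
      (𝓝 (Real.exp (-(t ^ 2 / 2)) : ℝ)) := by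
    have h1 : Tendsto (fun n : ℕ => (((n : ℝ) / (n + 1 : ℕ) : ℝ) : ℂ)) atTop (𝓝 ((1 : ℝ) : ℂ)) :=
      (Complex.continuous_ofReal.tendsto 1).comp hratio
    have h2 : Tendsto (fun n : ℕ => ((((n + 1 : ℕ) : ℝ)⁻¹ : ℝ) : ℂ)) atTop (𝓝 ((0 : ℝ) : ℂ)) :=
      (Complex.continuous_ofReal.tendsto 0).comp hinv
    have h3 := (h1.mul (h _ t hu)).add h2
    rw [Complex.ofReal_one, one_mul, Complex.ofReal_zero, add_zero] at h3
    refine h3.congr' ?_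
    filter_upwards [eventually_gt_atTop 0] with n hn
    have hN : (0 : ℝ) < n := by exact_mod_cast hn
    have e : t * √((n : ℝ) / (n + 1 : ℕ)) / σ / √(n : ℝ) = t * (σ * √((n + 1 : ℕ) : ℝ))⁻¹ := by
      have h4 : √(n : ℝ) ≠ 0 := (Real.sqrt_pos.2 hN).ne'
      rw [Real.sqrt_div hN.le]
      field_simp
    rw [e]
    push_cast
    ring
  have hdiff : Tendsto (fun n : ℕ => charFun (spectralMeasure
      ((σ * √((n + 1 : ℕ) : ℝ))⁻¹ • palindromicToeplitz x (n + 1))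
        (isHermitian_real_smul (palindromicToeplitz_isHermitian _ _) _) : Measure ℝ) t -
      ((n + 1 : ℕ) : ℂ)⁻¹ * (n * circCharFun x n (t * (σ * √((n + 1 : ℕ) : ℝ))⁻¹) + 1)) atTop (𝓝 0) := by
    rw [tendsto_zero_iff_norm_tendsto_zero]
    -- The border changes the squared Frobenius norm by O(n) before scaling, hence the
    -- characteristic function by O(n^(-1/2)).
    have hlim : Tendsto (fun n : ℕ => |t| / σ * √(((n + 1 : ℕ) : ℝ)⁻¹) * √(4 * K)) atTop (𝓝 0) := by
      simpa using (((Real.continuous_sqrt.tendsto 0).comp hinv).const_mul (|t| / σ)).mul_const (√(4 * K))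
    refine squeeze_zero' (Eventually.of_forall fun _ => norm_nonneg _) ?_ hlim
    filter_upwards [hK, eventually_gt_atTop 0] with n hn hn0
    have hN : (0 : ℝ) < n := by exact_mod_cast hn0
    refine (norm_charFun_spectralMeasure_palindromicToeplitz_sub_le x hn0 _ t _).trans ?_
    refine mul_le_mul (le_of_eq ?_) (Real.sqrt_le_sqrt ?_) (Real.sqrt_nonneg _) (by positivity)
    · rw [abs_mul, abs_of_nonneg (a := (σ * √((n + 1 : ℕ) : ℝ))⁻¹) (by positivity), mul_inv,
        Real.sqrt_inv]
      ring
    · rw [inv_mul_le_iff₀ hN] at hn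
      have hS : 0 ≤ ∑ j ∈ Finset.range (n / 2 + 1), x j ^ 2 := Finset.sum_nonneg fun _ _ => sq_nonneg _
      have hK0 : 0 ≤ K := by
        by_contra hneg
        have := mul_neg_of_pos_of_neg hN (not_le.1 hneg)
        linarith
      rw [div_le_iff₀ (by positivity)]
      push_cast
      nlinarith
  simpa using hdiff.add hmain

variable {Ω : Type*} [MeasurableSpace Ω] {P : Measure Ω} [IsProbabilityMeasure P] {X : ℕ → Ω → ℝ}

/-- Almost surely, the characteristic functions of the spectral measures of the symmetric circulant
matrices converge locally uniformly, and the empirical second moments are bounded. -/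
lemma ae_tendsto_circCharFun_of_third_moment (hmeas : ∀ j, Measurable (X j)) (hindep : iIndepFun X P)
    (hmom : ∀ j, Integrable (fun ω => |X j ω| ^ 3) P) {M : ℝ} (hM : ∀ j, ∫ ω, |X j ω| ^ 3 ∂P ≤ M)
    {m σ : ℝ} (hσ : 0 < σ) (hmean : ∀ j, ∫ ω, X j ω ∂P = m) (hvar : ∀ j, variance (X j) P = σ ^ 2) :
    ∀ᵐ ω ∂P, (∃ K : ℝ, ∀ᶠ n : ℕ in atTop,
        (n : ℝ)⁻¹ * ∑ j ∈ Finset.range (n / 2 + 1), X j ω ^ 2 ≤ K) ∧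
      ∀ (u : ℕ → ℝ) (t : ℝ), Tendsto u atTop (𝓝 t) →
        Tendsto (fun n : ℕ => circCharFun (fun j => X j ω) n (u n / σ / √(n : ℝ))) atTop
          (𝓝 (Real.exp (-(t ^ 2 / 2)) : ℝ)) := by
  set Y : ℕ → Ω → ℝ := fun j ω => X j ω - m with hY
  have hYmeas : ∀ j, Measurable (Y j) := fun j => (hmeas j).sub_const m
  have hYindep : iIndepFun Y P := hindep.comp (fun _ y => y - m) fun _ => measurable_id.sub_const m
  have hYb : ∀ j ω, |Y j ω| ^ 3 ≤ 4 * (|X j ω| ^ 3 + |m| ^ 3) := fun j ω =>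
    (pow_le_pow_left₀ (abs_nonneg _) (abs_sub _ _) 3).trans
      ((add_pow_le (abs_nonneg _) (abs_nonneg _) 3).trans_eq (by norm_num))
  have hbi : ∀ j, Integrable (fun ω => 4 * (|X j ω| ^ 3 + |m| ^ 3)) P := fun j =>
    ((hmom j).add (integrable_const _)).const_mul 4
  have hYmom : ∀ j, Integrable (fun ω => |Y j ω| ^ 3) P := fun j =>
    (hbi j).mono' ((continuous_abs.measurable.comp (hYmeas j)).pow_const 3).aestronglyMeasurable
      (ae_of_all _ fun ω => by
        rw [Real.norm_eq_abs, abs_of_nonneg (by positivity)]; exact hYb j ω)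
  have hYM : ∀ j, ∫ ω, |Y j ω| ^ 3 ∂P ≤ 4 * (M + |m| ^ 3) := fun j => by
    refine (integral_mono (hYmom j) (hbi j) (hYb j)).trans ?_
    rw [integral_const_mul, integral_add (hmom j) (integrable_const _)]
    simpa using hM j
  have hY0 : ∀ j, ∫ ω, Y j ω ∂P = 0 := fun j => by
    simp only [hY]
    rw [integral_sub (integrable_of_integrable_abs_pow_three (hmeas j) (hmom j)) (integrable_const _),
      hmean]
    simp
  have hY2 : ∀ j, ∫ ω, Y j ω ^ 2 ∂P = σ ^ 2 := fun j => by
    rw [← hvar j, variance_eq_integral (hmeas j).aemeasurable, hmean]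
  have hrat : ∀ᵐ ω ∂P, ∀ q : ℚ, Tendsto (fun n : ℕ => circCharFun (fun j => Y j ω) n (q / σ / √(n : ℝ)))
      atTop (𝓝 (Real.exp (-((q : ℝ) ^ 2 / 2)) : ℝ)) :=
    ae_all_iff.2 fun q => ae_tendsto_circCharFun hYmeas hYindep hYmom hYM hY0 hσ hY2 q
  filter_upwards [hrat, ae_eventually_sum_sq_le hYmeas hYindep hYmom hYM hY2] with ω h1 h2
  -- The constant comes from X² ≤ 2Y² + 2m² and the bound σ² + 2 for the centred variables.
  refine ⟨⟨2 * (σ ^ 2 + 2) + 2 * m ^ 2, ?_⟩, fun u t hu => ?_⟩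
  · filter_upwards [h2, eventually_gt_atTop 0] with n hn hn0
    have hN : (0 : ℝ) < n := by exact_mod_cast hn0
    rw [inv_mul_le_iff₀ hN] at hn ⊢
    have h3 : ∀ j ∈ Finset.range (n / 2 + 1), X j ω ^ 2 ≤ 2 * Y j ω ^ 2 + 2 * m ^ 2 := fun j _ => by
      simp only [hY]; nlinarith [sq_nonneg (X j ω - 2 * m)]
    refine (Finset.sum_le_sum h3).trans ?_
    rw [Finset.sum_add_distrib, ← Finset.mul_sum, Finset.sum_const, Finset.card_range, nsmul_eq_mul]
    have h4 : ((n / 2 + 1 : ℕ) : ℝ) ≤ n := by exact_mod_cast (show n / 2 + 1 ≤ n by omega)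
    have h5 := mul_le_mul_of_nonneg_right h4 (show 0 ≤ 2 * m ^ 2 by positivity)
    nlinarith
  · have h3 := tendsto_circCharFun_of_rat hσ h2 h1 hu
    have h4 : Tendsto (fun n : ℕ => circCharFun (fun j => X j ω) n (u n / σ / √(n : ℝ)) -
        circCharFun (fun j => Y j ω) n (u n / σ / √(n : ℝ))) atTop (𝓝 0) := by
      rw [tendsto_zero_iff_norm_tendsto_zero]
      refine squeeze_zero' (Eventually.of_forall fun _ => norm_nonneg _)
        ((eventually_gt_atTop 0).mono fun n hn => norm_circCharFun_sub_const_sub_le hn _ m _) ?_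
      exact tendsto_const_div_atTop_nhds_zero_nat 2
    simpa using h4.add h3

end Convergence

theorem mainTheorem4 {Ω : Type*} [MeasurableSpace Ω] (P : Measure Ω) [IsProbabilityMeasure P]
    (X : ℕ → Ω → ℝ) (hmeas : ∀ j, Measurable (X j)) (hindep : iIndepFun X P)
    (hmom : ∀ j, Integrable (fun ω => |X j ω| ^ 3) P)
    (hbdd : ∃ M : ℝ, ∀ j, ∫ ω, |X j ω| ^ 3 ∂P ≤ M)
    (m σ : ℝ) (hσ : 0 < σ)
    (hmean : ∀ j, ∫ ω, X j ω ∂P = m)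
    (hvar : ∀ j, variance (X j) P = σ ^ 2) :
    (∀ᵐ ω ∂P, Tendsto
      (fun n : ℕ => spectralMeasure
        ((σ * √((n + 1 : ℕ) : ℝ))⁻¹ • symCirculant (fun j => X j ω) (n + 1))
        (isHermitian_real_smul (symCirculant_isHermitian _ _) _))
      atTop (𝓝 (⟨gaussianReal 0 1, inferInstance⟩ : ProbabilityMeasure ℝ))) ∧
    (∀ᵐ ω ∂P, Tendsto
      (fun n : ℕ => spectralMeasure
        ((σ * √((n + 1 : ℕ) : ℝ))⁻¹ • palindromicToeplitz (fun j => X j ω) (n + 1))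
        (isHermitian_real_smul (palindromicToeplitz_isHermitian _ _) _))
      atTop (𝓝 (⟨gaussianReal 0 1, inferInstance⟩ : ProbabilityMeasure ℝ))) := by

  obtain ⟨M, hM⟩ := hbdd
  have h := ae_tendsto_circCharFun_of_third_moment hmeas hindep hmom hM hσ hmean hvar
  constructor
  · filter_upwards [h] with ω hω
    exact tendsto_spectralMeasure_symCirculant hω.2
  · filter_upwards [h] with ω hω
    obtain ⟨K, hK⟩ := hω.1
    exact tendsto_spectralMeasure_palindromicToeplitz hσ hK hω.2
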